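/- Let $\mu$ be the measure on the set $\mathbb{L}$ of affine lines of $\mathbb{R}^2$ defined as the pushforward of $\mathrm{Leb}_{\mathbb{R}}\otimes\mathrm{Haar}_{\mathbf{SO}(\mathbb{R}^2)}$ (Haar probability measure) by $(w,g)\mapsto g(\mathbb{R}\times\{w\})$; it is invariant under rotations and translations. Let $\beta>2$ and $c>0$, and let $\Pi$ be a Poisson process with intensity measure $c\cdot\mu\otimes v^{-\beta}\,\mathrm{d}v$ on $\mathbb{L}\times\mathbb{R}_+^*$. The atoms $(\ell,v)$ of $\Pi$ are called roads, $v$ being the speed of the road. Let $V(x)=\sup\{v:(\ell,v)\in\Pi,\ x\in\ell\}$ for $x\in\mathbb{R}^2$, with $\sup\emptyset=0$. For a function $W:\mathbb{R}^2\to[0,\infty]$, a $W$-path is a continuous path $\gamma:[0,\tau]\to\mathbb{R}^2$, $\tau\geq 0$, such that $|\gamma(t_2)-\gamma(t_1)|\leq\int_{t_1}^{t_2}W(\gamma(t))\,\mathrm{d}t$ for all $t_1\leq t_2$ in $[0,\tau]$. For $\varepsilon>0$, let $T_\varepsilon(x,y)$ be the infimum of the $\tau>0$ such that there is an $(\varepsilon\vee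 V)$-path $\gamma:[0,\tau]\to\mathbb{R}^2$ from $x$ to $y$. A geodesic $(\varepsilon\vee V)$-path is an $(\varepsilon\vee V)$-path $\gamma:[0,\tau]\to\mathbb{R}^2$ with $\tau=T_\varepsilon(\gamma(0),\gamma(\tau))$. A path $\gamma$ drives linearly at speed $s$ between the times $a\le b$ if there is a unit vector $e$ with $\gamma(t)=\gamma(a)+(t-a)s\,e$ for all $t\in[a,b]$; it drives using the road $(\ell,v)$ between the times $a\le b$ if moreover $\gamma([a,b])\subset\ell$ and $s=v$. A simple $V$-path is a $V$-path $\gamma:[0,\tau]\to\mathbb{R}^2$ for which there are $k\geq 0$, a subdivision $0=t_0<\ldots<t_k=\tau$ and roads $(\ell_1,v_1),\ldots,(\ell_k,v_k)\in\Pi$ such that, for each $1\le i\le k$, $\gamma$ drives using $(\ell_i,v_i)$ between the times $t_{i-1}$ and $t_i$. Fix $\varepsilon>0$. Almost surely, every geodesic $(\varepsilon\vee V)$-path $\gamma:[0,\tau]\to\mathbb{R}^2$ has the following structure: there exist an integer $k\geq 0$, times $0\leq t_0<\ldots<t_k\leq\tau$, and roads $(\ell_1,v_1),\ldots,(\ell_k,v_k)\in\Pi$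 with speeds greater than $\varepsilon$, such that: - $\gamma$ drives linearly at speed $\varepsilon$ between the times $0$ and $t_0$; - for each $1\le i\le k$, $\gamma$ drives using the road $(\ell_i,v_i)$ between the times $t_{i-1}$ and $t_i$; - $\gamma$ drives linearly at speed $\varepsilon$ between the times $t_k$ and $\tau$. In particular, the restriction of $\gamma$ to $[t_0,t_k]$ (with time shifted by $t_0$) is a simple $V$-path. -/

import Mathlib

open Set MeasureTheory ProbabilityTheory
open scoped ENNReal NNReal

noncomputable section

namespace PoissonRoads

/-- The Euclidean plane. -/
abbrev Plane : Type := EuclideanSpace ℝ (Fin 2)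

/-! ### The space of lines and its invariant measure -/

/-- An affine line of the plane. -/
structure Line where
  /-- the set of points of the line, as an affine subspace -/
  carrier : AffineSubspace ℝ Plane
  /-- the line has dimension one -/
  finrank_direction : Module.finrank ℝ carrier.direction = 1

/-- The rotation of angle `θ` around the origin. -/
def rotate (θ : ℝ) (x : Plane) : Plane :=
  !₂[Real.cos θ * x 0 - Real.sin θ * x 1, Real.sin θ * x 0 + Real.cos θ * x 1]

theorem rotate_e1_ne_zero (θ : ℝ) : rotate θ !₂[1, 0] ≠ 0 := by
  intro h
  have h0 : Real.cos θ = 0 := by simpa [rotate] using congrArg (fun x : Plane => x 0) h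
  have h1 : Real.sin θ = 0 := by simpa [rotate] using congrArg (fun x : Plane => x 1) h
  have := Real.sin_sq_add_cos_sq θ
  simp [h0, h1] at this

/-- The parametrization of the space of lines: `(w, θ)` is sent to the image, under the rotation of
angle `θ`, of the horizontal line through the point `(0, w)`. -/
def lineOf (p : ℝ × ℝ) : Line where
  carrier := AffineSubspace.mk' (rotate p.2 !₂[0, p.1]) (Submodule.span ℝ {rotate p.2 !₂[1, 0]})
  finrank_direction := by
    rw [AffineSubspace.direction_mk']
    exact finrank_span_singleton (rotate_e1_ne_zero p.2)

/-- The finest topology on the space of lines for which the parametrization is continuous. -/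
instance : TopologicalSpace Line := TopologicalSpace.coinduced lineOf inferInstance

instance : MeasurableSpace Line := borel Line

instance : BorelSpace Line := ⟨rfl⟩

theorem measurable_lineOf : Measurable lineOf :=
  (continuous_coinduced_rng : Continuous lineOf).measurable

/-- The uniform probability measure on the interval `(0, 2π]` of angles; the rotation with such a
random angle is distributed according to the Haar probability measure of `SO(ℝ²)`. -/
def angleMeasure : Measure ℝ :=
  (ENNReal.ofReal (2 * Real.pi))⁻¹ • volume.restrict (Ioc 0 (2 * Real.pi))

/-- The measure on the space of lines that is invariant under rotations and translations, and that
gives mass `2 r` to the set of lines that hit a given closed ball of radius `r`. -/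
def lineMeasure : Measure Line :=
  ((volume : Measure ℝ).prod angleMeasure).map lineOf

/-! ### Roads and the Poisson process of roads -/

/-- A road: a line together with a positive speed limit. -/
abbrev Road : Type := Line × Ioi (0 : ℝ)

/-- The measure `v ^ (-β) dv` on the space `(0, ∞)` of speeds. -/
def speedMeasure (β : ℝ) : Measure (Ioi (0 : ℝ)) :=
  ((volume : Measure ℝ).comap ((↑) : Ioi (0 : ℝ) → ℝ)).withDensity fun v =>
    ENNReal.ofReal ((v : ℝ) ^ (-β))

/-- The intensity measure `c · μ ⊗ v ^ (-β) dv` of the process of roads. -/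
def roadIntensity (β c : ℝ) : Measure Road :=
  ENNReal.ofReal c • lineMeasure.prod (speedMeasure β)

/-- The Poisson law with parameter `m ∈ [0, ∞]`, on `{0, 1, 2, …, ∞}`. -/
def poissonLaw (m : ℝ≥0∞) : Measure ℕ∞ :=
  open scoped Classical in
  if m = ∞ then Measure.dirac ⊤ else (poissonMeasure m.toNNReal).map ((↑) : ℕ → ℕ∞)

/-- `R` is (the random set of atoms of) a Poisson process with intensity `ν`: the number of points
in a Borel set `B` is a Poisson random variable with parameter `ν B`, and the numbers of points in
pairwise disjoint Borel sets are independent. -/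
structure IsPoissonProcess {Ω X : Type*} [MeasurableSpace Ω] [MeasurableSpace X]
    (P : Measure Ω) (ν : Measure X) (R : Ω → Set X) : Prop where
  measurable_count : ∀ B : Set X, MeasurableSet B → Measurable fun ω => (R ω ∩ B).encard
  map_count : ∀ B : Set X, MeasurableSet B →
    P.map (fun ω => (R ω ∩ B).encard) = poissonLaw (ν B)
  indep_count : ∀ (n : ℕ) (B : Fin n → Set X), (∀ i, MeasurableSet (B i)) →
    Pairwise (fun i j => Disjoint (B i) (B j)) →
    iIndepFun (fun i ω => (R ω ∩ B i).encard) P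

/-! ### Paths that respect speed limits, and driving times -/

/-- The speed limit `V(x)` at the point `x`: the supremum of the speeds of the roads of `R` that
pass through `x`, with the convention `sup ∅ = 0`. -/
def speedLimit (R : Set Road) (x : Plane) : ℝ≥0∞ :=
  ⨆ r ∈ R, ⨆ _ : x ∈ r.1.carrier, ENNReal.ofReal (r.2 : ℝ)

/-- The speed limit `ε ∨ V`. -/
def maxSpeedLimit (ε : ℝ) (R : Set Road) (x : Plane) : ℝ≥0∞ :=
  max (ENNReal.ofReal ε) (speedLimit R x)

/-- The restriction of `γ` to `[0, τ]` is a `W`-path: it is continuous and it respects the speed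
limits set by `W`. -/
def IsPath (W : Plane → ℝ≥0∞) (τ : ℝ) (γ : ℝ → Plane) : Prop :=
  0 ≤ τ ∧ ContinuousOn γ (Icc 0 τ) ∧
    ∀ t₁ ∈ Icc 0 τ, ∀ t₂ ∈ Icc 0 τ, t₁ ≤ t₂ →
      edist (γ t₁) (γ t₂) ≤ ∫⁻ t in Icc t₁ t₂, W (γ t)

/-- The infimum of the `τ > 0` such that there is a `W`-path defined on `[0, τ]` from `x` to `y`. -/
def drivingTime (W : Plane → ℝ≥0∞) (x y : Plane) : ℝ≥0∞ :=
  ⨅ (τ : ℝ) (_ : 0 < τ) (_ : ∃ γ, IsPath W τ γ ∧ γ 0 = x ∧ γ τ = y), ENNReal.ofReal τ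

/-- The restriction of `γ` to `[0, τ]` is a geodesic `W`-path: a `W`-path whose driving time is the
least possible between its endpoints. -/
def IsGeodesicPath (W : Plane → ℝ≥0∞) (τ : ℝ) (γ : ℝ → Plane) : Prop :=
  IsPath W τ γ ∧ ENNReal.ofReal τ = drivingTime W (γ 0) (γ τ)

/-- Between the times `a` and `b`, the path `γ` drives linearly at speed `s`. -/
def DrivesLinearly (γ : ℝ → Plane) (a b s : ℝ) : Prop :=
  ∃ e : Plane, ‖e‖ = 1 ∧ ∀ t ∈ Icc a b, γ t = γ a + ((t - a) * s) • e

/-- Between the times `a` and `b`, the path `γ` drives using the road `r`: it stays on the line of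
`r` and drives linearly at the speed of `r`. -/
def DrivesUsing (γ : ℝ → Plane) (a b : ℝ) (r : Road) : Prop :=
  (∀ t ∈ Icc a b, γ t ∈ r.1.carrier) ∧ DrivesLinearly γ a b r.2

/-- The restriction of `γ` to `[0, τ]` is a simple `V`-path: a `V`-path for which there is a
subdivision `0 = t 0 < t 1 < … < t k = τ` such that `γ` uses one road of `R` between any two
consecutive times of the subdivision. -/
def IsSimplePath (R : Set Road) (τ : ℝ) (γ : ℝ → Plane) : Prop :=
  IsPath (speedLimit R) τ γ ∧
    ∃ (k : ℕ) (t : Fin (k + 1) → ℝ) (r : Fin k → Road),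
      StrictMono t ∧ t 0 = 0 ∧ t (Fin.last k) = τ ∧
      ∀ i : Fin k, r i ∈ R ∧ DrivesUsing γ (t i.castSucc) (t i.succ) (r i)

end PoissonRoads

end

/-! Call a road fast if its speed exceeds `ε`. Two almost sure properties force the structure:
finitely many fast roads meet any ball (`FinitelyManyFastRoads`), and no off-road direction makes
with two distinct fast roads the angle of cosine `ε / v` prescribed by refraction
(`NoDoubleRefraction`). Given these, the argument is deterministic.

On either side of a given time, finiteness leaves two cases. If no fast road is met arbitrarily
close to that time, the speed is at most `ε` and the straight line is optimal. Otherwise there is a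
fastest such road, and between two visits to it nothing beats following it. In both cases equality
in the triangle inequality makes the geodesic linear. A supremum argument chains these pieces into
finitely many (`IsGeodesicPath.isStructured`). An off-road piece between two roads is impossible
(`IsGeodesicPath.not_offroad_between`): on a single fast road it is quicker to stay, and for
distinct roads, sliding the exit and entry points gives the law of refraction at both ends of one
segment.

On the probabilistic side, the angle of a line has a diffuse law for each fixed speed, so the
observable `refractionCos`, which encodes a refraction direction, has no atoms under the intensity.
`IsPoissonProcess.ae_ne` then shows that distinct roads do not share its value. -/

namespace PoissonRoads

/-! ### Paths that respect speed limits on an interval -/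

/-- Between the times `a` and `b`, the path `γ` respects the speed limits set by `W`. -/
def RespectsSpeedLimit (W : Plane → ℝ≥0∞) (γ : ℝ → Plane) (a b : ℝ) : Prop :=
  ∀ t₁ ∈ Icc a b, ∀ t₂ ∈ Icc a b, t₁ ≤ t₂ → edist (γ t₁) (γ t₂) ≤ ∫⁻ t in Icc t₁ t₂, W (γ t)

/-- No measurability of `f` is asked, because `W ∘ γ` need not be measurable: only the domain is
split, up to a null endpoint. -/
theorem setLIntegral_Icc_add_Icc (f : ℝ → ℝ≥0∞) {a b c : ℝ} (hab : a ≤ b) (hbc : b ≤ c) :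
    (∫⁻ t in Icc a b, f t) + ∫⁻ t in Icc b c, f t = ∫⁻ t in Icc a c, f t := by
  rw [← setLIntegral_congr (Ioc_ae_eq_Icc (a := b) (b := c)),
    ← Icc_union_Ioc_eq_Icc hab hbc, lintegral_union measurableSet_Ioc]
  exact disjoint_left.2 fun x hx hx' => not_lt.2 hx.2 hx'.1

theorem setLIntegral_Icc_add_left (f : ℝ → ℝ≥0∞) (a s t : ℝ) :
    ∫⁻ x in Icc s t, f (a + x) = ∫⁻ x in Icc (a + s) (a + t), f x := by
  rw [← (measurePreserving_add_left volume a).setLIntegral_comp_preimage_emb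
    (measurableEmbedding_addLeft a) f (Icc (a + s) (a + t))]
  simp

section RespectsSpeedLimit

variable {W : Plane → ℝ≥0∞} {γ η : ℝ → Plane} {a b c d : ℝ}

theorem RespectsSpeedLimit.mono (h : RespectsSpeedLimit W γ a b) (hac : a ≤ c) (hdb : d ≤ b) :
    RespectsSpeedLimit W γ c d := fun t₁ h₁ t₂ h₂ =>
  h t₁ ⟨hac.trans h₁.1, h₁.2.trans hdb⟩ t₂ ⟨hac.trans h₂.1, h₂.2.trans hdb⟩

theorem RespectsSpeedLimit.union (h₁ : RespectsSpeedLimit W γ a b)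
    (h₂ : RespectsSpeedLimit W γ b c) : RespectsSpeedLimit W γ a c := by
  intro s hs t ht hst
  rcases le_total t b with htb | hbt
  · exact h₁ s ⟨hs.1, hst.trans htb⟩ t ⟨ht.1, htb⟩ hst
  rcases le_total b s with hbs | hsb
  · exact h₂ s ⟨hbs, hs.2⟩ t ⟨hbs.trans hst, ht.2⟩ hst
  calc edist (γ s) (γ t) ≤ edist (γ s) (γ b) + edist (γ b) (γ t) := edist_triangle _ _ _
    _ ≤ (∫⁻ x in Icc s b, W (γ x)) + ∫⁻ x in Icc b t, W (γ x) :=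
      add_le_add (h₁ s ⟨hs.1, hsb⟩ b ⟨hs.1.trans hsb, le_rfl⟩ hsb)
        (h₂ b ⟨le_rfl, hbt.trans ht.2⟩ t ⟨hbt, ht.2⟩ hbt)
    _ = _ := setLIntegral_Icc_add_Icc _ hsb hbt

theorem RespectsSpeedLimit.congr (h : RespectsSpeedLimit W γ a b) (hγ : EqOn η γ (Icc a b)) :
    RespectsSpeedLimit W η a b := by
  intro s hs t ht hst
  rw [hγ hs, hγ ht]
  refine (h s hs t ht hst).trans_eq (setLIntegral_congr_fun measurableSet_Icc fun x hx => ?_)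
  simp only [hγ ⟨hs.1.trans hx.1, hx.2.trans ht.2⟩]

theorem RespectsSpeedLimit.shift (h : RespectsSpeedLimit W γ (a + c) (b + c)) :
    RespectsSpeedLimit W (fun s => γ (c + s)) a b := by
  intro s hs t ht hst
  rw [setLIntegral_Icc_add_left (fun x => W (γ x))]
  exact h _ ⟨by linarith [hs.1], by linarith [hs.2]⟩ _ ⟨by linarith [ht.1], by linarith [ht.2]⟩
    (by linarith)

theorem DrivesLinearly.respectsSpeedLimit {s : ℝ} (h : DrivesLinearly γ a b s) (hs : 0 ≤ s)
    (hW : ∀ t ∈ Icc a b, ENNReal.ofReal s ≤ W (γ t)) : RespectsSpeedLimit W γ a b := by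
  obtain ⟨e, he, h⟩ := h
  intro t₁ h₁ t₂ h₂ hle
  have hd : edist (γ t₁) (γ t₂) = ENNReal.ofReal s * ENNReal.ofReal (t₂ - t₁) := by
    rw [h t₁ h₁, h t₂ h₂, edist_add_left, edist_comm, edist_dist, dist_eq_norm, ← sub_smul,
      norm_smul, he, mul_one, ← ENNReal.ofReal_mul hs, Real.norm_of_nonneg]
    · ring_nf
    · nlinarith
  calc edist (γ t₁) (γ t₂) = ∫⁻ _ in Icc t₁ t₂, ENNReal.ofReal s := by simp [hd]
    _ ≤ _ := setLIntegral_mono' measurableSet_Icc fun x hx =>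
      hW x ⟨h₁.1.trans hx.1, hx.2.trans h₂.2⟩

/-- The endpoints form a null set, so a bound inside suffices; a path may well start or end a piece
on a faster road. -/
theorem RespectsSpeedLimit.dist_le {v : ℝ} (h : RespectsSpeedLimit W γ a b) (hv : 0 ≤ v)
    (hW : ∀ t ∈ Ioo a b, W (γ t) ≤ ENNReal.ofReal v) {s t : ℝ} (hs : a ≤ s) (hst : s ≤ t)
    (ht : t ≤ b) : dist (γ s) (γ t) ≤ v * (t - s) := by
  have h₁ : edist (γ s) (γ t) ≤ ENNReal.ofReal (v * (t - s)) :=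
    calc edist (γ s) (γ t) ≤ ∫⁻ x in Icc s t, W (γ x) :=
          h s ⟨hs, hst.trans ht⟩ t ⟨hs.trans hst, ht⟩ hst
      _ = ∫⁻ x in Ioo s t, W (γ x) := (setLIntegral_congr Ioo_ae_eq_Icc).symm
      _ ≤ ∫⁻ _ in Ioo s t, ENNReal.ofReal v := setLIntegral_mono' measurableSet_Ioo fun x hx =>
          hW x ⟨hs.trans_lt hx.1, hx.2.trans_le ht⟩
      _ = _ := by simp [ENNReal.ofReal_mul hv]
  rwa [edist_dist, ENNReal.ofReal_le_ofReal_iff (mul_nonneg hv (by linarith))] at h₁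

end RespectsSpeedLimit

/-! ### Driving linearly -/

theorem exists_norm_eq_one : ∃ e : Plane, ‖e‖ = 1 := exists_norm_eq Plane zero_le_one

theorem drivesLinearly_self (γ : ℝ → Plane) (a s : ℝ) : DrivesLinearly γ a a s := by
  obtain ⟨e, he⟩ := exists_norm_eq_one
  refine ⟨e, he, fun t ht => ?_⟩
  simp [le_antisymm ht.2 ht.1]

section DrivesLinearly

variable {γ : ℝ → Plane} {a b c d s v : ℝ} {r : Road}

theorem DrivesLinearly.mono (h : DrivesLinearly γ a b s) (hac : a ≤ c) (hdb : d ≤ b) :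
    DrivesLinearly γ c d s := by
  obtain ⟨e, he, h⟩ := h
  refine ⟨e, he, fun t ht => ?_⟩
  rw [h t ⟨hac.trans ht.1, ht.2.trans hdb⟩, h c ⟨hac, (ht.1.trans ht.2).trans hdb⟩, add_assoc,
    ← add_smul]
  ring_nf

theorem DrivesUsing.mono (h : DrivesUsing γ a b r) (hac : a ≤ c) (hdb : d ≤ b) :
    DrivesUsing γ c d r :=
  ⟨fun t ht => h.1 t ⟨hac.trans ht.1, ht.2.trans hdb⟩, h.2.mono hac hdb⟩

theorem DrivesLinearly.shift (h : DrivesLinearly γ (a + c) (b + c) s) :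
    DrivesLinearly (fun x => γ (c + x)) a b s := by
  obtain ⟨e, he, h⟩ := h
  refine ⟨e, he, fun t ht => ?_⟩
  simp only
  rw [h (c + t) ⟨by linarith [ht.1], by linarith [ht.2]⟩]
  ring_nf

theorem DrivesUsing.shift (h : DrivesUsing γ (a + c) (b + c) r) :
    DrivesUsing (fun x => γ (c + x)) a b r :=
  ⟨fun t ht => h.1 _ ⟨by linarith [ht.1], by linarith [ht.2]⟩, h.2.shift⟩

theorem DrivesLinearly.dist_eq (h : DrivesLinearly γ a b s) (hs : 0 ≤ s) {t u : ℝ}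
    (ht : a ≤ t) (htu : t ≤ u) (hu : u ≤ b) : dist (γ t) (γ u) = s * (u - t) := by
  obtain ⟨e, he, h⟩ := h
  rw [h t ⟨ht, htu.trans hu⟩, h u ⟨ht.trans htu, hu⟩, dist_add_left, dist_comm, dist_eq_norm,
    ← sub_smul, norm_smul, he, mul_one, Real.norm_of_nonneg]
  · ring
  · nlinarith

/-- A path that moves at speed at most `v` and travels the distance `v * (b - a)` between the times
`a` and `b` is linear between these times. -/
theorem drivesLinearly_of_dist_le (hv : 0 < v) (hab : a ≤ b)
    (h₁ : ∀ t ∈ Icc a b, dist (γ a) (γ t) ≤ v * (t - a))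
    (h₂ : ∀ t ∈ Icc a b, dist (γ t) (γ b) ≤ v * (b - t))
    (h : v * (b - a) ≤ dist (γ a) (γ b)) : DrivesLinearly γ a b v := by
  rcases hab.eq_or_lt with rfl | hab
  · exact drivesLinearly_self γ a v
  have hd : dist (γ a) (γ b) = v * (b - a) := le_antisymm (h₁ b ⟨hab.le, le_rfl⟩) h
  have hpos : 0 < v * (b - a) := mul_pos hv (sub_pos.2 hab)
  refine ⟨(v * (b - a))⁻¹ • (γ b - γ a), ?_, fun t ht => ?_⟩
  · rw [norm_smul, ← dist_eq_norm, dist_comm, hd, Real.norm_of_nonneg (inv_pos.2 hpos).le,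
      inv_mul_cancel₀ hpos.ne']
  · have htri := dist_triangle (γ a) (γ t) (γ b)
    have e₁ := h₁ t ht
    have e₂ := h₂ t ht
    have hba : b - a ≠ 0 := (sub_pos.2 hab).ne'
    -- The triangle inequality turns `e₁` and `e₂` into equalities, and strict convexity of the norm
    -- then determines `γ t`.
    have key := eq_lineMap_of_dist_eq_mul_of_dist_eq_mul (r := (t - a) / (b - a))
      (x := γ a) (y := γ t) (z := γ b)
      (by rw [hd]; field_simp; linarith) (by rw [hd]; field_simp; linarith)
    rw [key, AffineMap.lineMap_apply, vsub_eq_sub, vadd_eq_add, smul_smul, add_comm]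
    congr 2
    field_simp

end DrivesLinearly

/-! ### Travelling between two points in a given time -/

/-- There is a `W`-path from `x` to `y` defined on `[0, τ]`. -/
def Reach (W : Plane → ℝ≥0∞) (x y : Plane) (τ : ℝ) : Prop :=
  ∃ γ, IsPath W τ γ ∧ γ 0 = x ∧ γ τ = y

section Reach

variable {W : Plane → ℝ≥0∞} {γ : ℝ → Plane} {x y z : Plane} {τ a b : ℝ}

theorem Reach.trans {σ : ℝ} (h₁ : Reach W x y σ) (h₂ : Reach W y z τ) :
    Reach W x z (σ + τ) := by
  obtain ⟨γ₁, ⟨hσ, hc₁, h₁⟩, rfl, e₁⟩ := h₁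
  obtain ⟨γ₂, ⟨hτ, hc₂, h₂⟩, e₂, rfl⟩ := h₂
  set γ : ℝ → Plane := fun t => if t ≤ σ then γ₁ t else γ₂ (-σ + t) with hγ
  have eq₁ : EqOn γ γ₁ (Icc 0 σ) := fun t ht => by simp [hγ, ht.2]
  have eq₂ : EqOn γ (fun t => γ₂ (-σ + t)) (Icc σ (σ + τ)) := fun t ht => by
    rcases ht.1.eq_or_lt with rfl | h
    · simp [hγ, e₁, e₂]
    · simp [hγ, not_le.2 h]
  refine ⟨γ, ⟨add_nonneg hσ hτ, ?_, ?_⟩, eq₁ ⟨le_rfl, hσ⟩, ?_⟩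
  · have c₁ : ContinuousOn γ (Icc 0 σ) := hc₁.congr eq₁
    have c₂ : ContinuousOn γ (Icc σ (σ + τ)) := by
      refine ContinuousOn.congr (hc₂.comp (by fun_prop) fun t ht => ?_) eq₂
      exact ⟨by linarith [ht.1], by linarith [ht.2]⟩
    rw [← Icc_union_Icc_eq_Icc hσ (le_add_of_nonneg_right hτ)]
    exact c₁.union_of_isClosed c₂ isClosed_Icc isClosed_Icc
  · have r₁ : RespectsSpeedLimit W γ 0 σ := RespectsSpeedLimit.congr h₁ eq₁
    have r₂ : RespectsSpeedLimit W γ σ (σ + τ) := by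
      refine RespectsSpeedLimit.congr (RespectsSpeedLimit.shift ?_) eq₂
      convert! (show RespectsSpeedLimit W γ₂ 0 τ from h₂) using 1 <;> ring
    exact r₁.union r₂
  · rw [eq₂ ⟨le_add_of_nonneg_right hτ, le_rfl⟩]
    simp

theorem IsPath.respectsSpeedLimit (h : IsPath W τ γ) : RespectsSpeedLimit W γ 0 τ := h.2.2

theorem IsPath.reach (h : IsPath W τ γ) (ha : 0 ≤ a) (hab : a ≤ b) (hb : b ≤ τ) :
    Reach W (γ a) (γ b) (b - a) := by
  refine ⟨fun s => γ (a + s), ⟨by linarith, ?_, ?_⟩, by simp, by simp⟩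
  · exact h.2.1.comp (by fun_prop) fun t ht => ⟨by linarith [ht.1], by linarith [ht.2]⟩
  · exact RespectsSpeedLimit.shift (h.respectsSpeedLimit.mono (by linarith) (by linarith))

theorem reach_of_speed_le {v : ℝ} (hv : 0 < v)
    (hW : ∀ t ∈ Icc (0 : ℝ) 1, ENNReal.ofReal v ≤ W (AffineMap.lineMap x y t)) :
    Reach W x y (dist x y / v) := by
  obtain ⟨e, he, hxy⟩ : ∃ e : Plane, ‖e‖ = 1 ∧ y = x + dist x y • e := by
    rcases eq_or_ne x y with rfl | hne
    · obtain ⟨e, he⟩ := exists_norm_eq_one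
      exact ⟨e, he, by simp⟩
    · have hd := dist_pos.2 hne
      refine ⟨(dist x y)⁻¹ • (y - x), ?_, ?_⟩
      · rw [norm_smul, ← dist_eq_norm, dist_comm y x, Real.norm_of_nonneg (inv_pos.2 hd).le,
          inv_mul_cancel₀ hd.ne']
      · rw [smul_smul, mul_inv_cancel₀ hd.ne', one_smul, add_sub_cancel]
  set L := dist x y with hL
  have hL0 : 0 ≤ L := dist_nonneg
  have hlin : DrivesLinearly (fun t => x + (t * v) • e) 0 (L / v) v :=
    ⟨e, he, fun t _ => by simp⟩
  refine ⟨_, ⟨by positivity, by fun_prop, hlin.respectsSpeedLimit hv.le fun t ht => ?_⟩,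
    by simp, by simp [div_mul_cancel₀ L hv.ne', ← hxy]⟩
  have ht' : t * v ≤ L := (le_div_iff₀ hv).1 ht.2
  rcases hL0.eq_or_lt with h0 | hpos
  · have : t * v = 0 := le_antisymm (by linarith) (mul_nonneg ht.1 hv.le)
    simpa [this] using hW 0 (by simp)
  · convert hW (t * v / L) ⟨div_nonneg (mul_nonneg ht.1 hv.le) hL0, (div_le_one hpos).2 ht'⟩
      using 2
    rw [AffineMap.lineMap_apply, vsub_eq_sub, vadd_eq_add, hxy, add_sub_cancel_left, smul_smul,
      div_mul_cancel₀ _ hpos.ne', add_comm]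

theorem Reach.drivingTime_le (h : Reach W x y τ) : drivingTime W x y ≤ ENNReal.ofReal τ := by
  obtain ⟨γ, hγ, rfl, rfl⟩ := h
  rcases hγ.1.eq_or_lt with rfl | hτ
  -- The infimum runs over positive durations only, so duration `0` is approached by constant paths
  -- of duration `δ`.
  · refine ENNReal.le_of_forall_pos_le_add fun δ hδ _ => ?_
    refine (iInf₂_le_of_le (δ : ℝ) hδ (iInf_le_of_le ⟨fun _ => γ 0, ?_, rfl, rfl⟩ le_rfl)).trans
      (by simp)
    exact ⟨δ.2, continuousOn_const, by simp⟩
  · exact iInf₂_le_of_le τ hτ (iInf_le_of_le ⟨γ, hγ, rfl, rfl⟩ le_rfl)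

/-- A competitor between intermediate points can be spliced into the path, so every piece of a
geodesic is optimal. -/
theorem IsGeodesicPath.le_of_reach (h : IsGeodesicPath W τ γ) (ha : 0 ≤ a) (hab : a ≤ b)
    (hb : b ≤ τ) {σ : ℝ} (hr : Reach W (γ a) (γ b) σ) : b - a ≤ σ := by
  have h₁ := ((h.1.reach le_rfl ha (hab.trans hb)).trans hr).trans
    (h.1.reach (ha.trans hab) hb le_rfl)
  have h₂ := h₁.drivingTime_le
  obtain ⟨_, hη, _⟩ := h₁
  rw [← h.2, ENNReal.ofReal_le_ofReal_iff hη.1] at h₂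
  linarith

/-- A piece of a geodesic on which the speed limit does not exceed `v`, and between whose endpoints
one cannot do better than driving straight at speed `v`, is linear. -/
theorem IsPath.drivesLinearly {v : ℝ} (h : IsPath W τ γ) (hv : 0 < v) (ha : 0 ≤ a) (hab : a ≤ b)
    (hb : b ≤ τ) (hW : ∀ t ∈ Ioo a b, W (γ t) ≤ ENNReal.ofReal v)
    (hd : v * (b - a) ≤ dist (γ a) (γ b)) : DrivesLinearly γ a b v := by
  have h' := h.respectsSpeedLimit.mono ha hb
  exact drivesLinearly_of_dist_le hv hab (fun t ht => h'.dist_le hv.le hW le_rfl ht.1 ht.2)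
    (fun t ht => h'.dist_le hv.le hW ht.1 ht.2 le_rfl) hd

end Reach

/-! ### Speed limits set by roads -/

section Roads

variable {R : Set Road} {ε τ a b c : ℝ} {x y : Plane} {γ : ℝ → Plane} {r : Road}

theorem le_speedLimit (hr : r ∈ R) (hx : x ∈ r.1.carrier) :
    ENNReal.ofReal r.2 ≤ speedLimit R x :=
  le_iSup₂_of_le r hr (le_iSup_of_le hx le_rfl)

theorem reach_offroad (hε : 0 < ε) (R : Set Road) (x y : Plane) :
    Reach (maxSpeedLimit ε R) x y (dist x y / ε) :=
  reach_of_speed_le hε fun _ _ => le_max_left _ _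

theorem reach_road (hr : r ∈ R) (hx : x ∈ r.1.carrier) (hy : y ∈ r.1.carrier) :
    Reach (maxSpeedLimit ε R) x y (dist x y / r.2) :=
  reach_of_speed_le r.2.2 fun t _ =>
    (le_speedLimit hr (AffineMap.lineMap_mem t hx hy)).trans (le_max_right _ _)

theorem IsGeodesicPath.le_dist_offroad (h : IsGeodesicPath (maxSpeedLimit ε R) τ γ) (hε : 0 < ε)
    (ha : 0 ≤ a) (hab : a ≤ b) (hb : b ≤ τ) : ε * (b - a) ≤ dist (γ a) (γ b) := by
  have := h.le_of_reach ha hab hb (reach_offroad hε R _ _)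
  rwa [le_div_iff₀ hε, mul_comm] at this

theorem IsGeodesicPath.le_dist_road (h : IsGeodesicPath (maxSpeedLimit ε R) τ γ)
    (ha : 0 ≤ a) (hab : a ≤ b) (hb : b ≤ τ) (hr : r ∈ R) (hra : γ a ∈ r.1.carrier)
    (hrb : γ b ∈ r.1.carrier) : (r.2 : ℝ) * (b - a) ≤ dist (γ a) (γ b) := by
  have := h.le_of_reach ha hab hb (reach_road hr hra hrb)
  rwa [le_div_iff₀ r.2.2, mul_comm] at this

/-- Two consecutive off-road pieces of a geodesic are aligned. -/
theorem IsGeodesicPath.drivesLinearly_union (h : IsGeodesicPath (maxSpeedLimit ε R) τ γ)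
    (hε : 0 < ε) (ha : 0 ≤ a) (hab : a ≤ b) (hbc : b ≤ c) (hc : c ≤ τ)
    (h₁ : DrivesLinearly γ a b ε) (h₂ : DrivesLinearly γ b c ε) : DrivesLinearly γ a c ε := by
  refine drivesLinearly_of_dist_le hε (hab.trans hbc) (fun t ht => ?_) (fun t ht => ?_)
    (h.le_dist_offroad hε ha (hab.trans hbc) hc)
  · rcases le_total t b with htb | hbt
    · exact (h₁.dist_eq hε.le le_rfl ht.1 htb).le
    · have e₁ := h₁.dist_eq hε.le le_rfl hab le_rfl
      have e₂ := h₂.dist_eq hε.le le_rfl hbt ht.2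
      linarith [dist_triangle (γ a) (γ b) (γ t)]
  · rcases le_total t b with htb | hbt
    · have e₁ := h₁.dist_eq hε.le ht.1 htb le_rfl
      have e₂ := h₂.dist_eq hε.le le_rfl hbc le_rfl
      linarith [dist_triangle (γ t) (γ b) (γ c)]
    · exact (h₂.dist_eq hε.le hbt ht.2 le_rfl).le

/-- A linear piece of a path between two points of a road stays on the line of the road. -/
theorem DrivesLinearly.drivesUsing (h : DrivesLinearly γ a b r.2) (hab : a < b)
    (ha : γ a ∈ r.1.carrier) (hb : γ b ∈ r.1.carrier) : DrivesUsing γ a b r := by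
  refine ⟨fun t ht => ?_, h⟩
  obtain ⟨e, -, h⟩ := h
  have key : γ t = AffineMap.lineMap (γ a) (γ b) ((t - a) / (b - a)) := by
    have hba : b - a ≠ 0 := (sub_pos.2 hab).ne'
    rw [AffineMap.lineMap_apply, vsub_eq_sub, vadd_eq_add, h t ht, h b ⟨hab.le, le_rfl⟩,
      add_sub_cancel_left, smul_smul, add_comm]
    congr 2
    field_simp
  rw [key]
  exact AffineMap.lineMap_mem _ ha hb

end Roads

/-! ### The two properties of the roads on which the deterministic argument rests. -/

open Filter Topology

/-- Finitely many roads of speed greater than `ε` hit any given ball. -/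
def FinitelyManyFastRoads (ε : ℝ) (R : Set Road) : Prop :=
  ∀ n : ℕ, {r ∈ R | ε < (r.2 : ℝ) ∧ ∃ x ∈ r.1.carrier, ‖x‖ ≤ n}.Finite

/-- No direction `e` of off-road driving satisfies the law of refraction both with respect to two
distinct fast roads. -/
def NoDoubleRefraction (ε : ℝ) (R : Set Road) : Prop :=
  ∀ r₁ ∈ R, ∀ r₂ ∈ R, ε < (r₁.2 : ℝ) → ε < (r₂.2 : ℝ) → r₁ ≠ r₂ →
    ∀ e u₁ u₂ : Plane, ‖e‖ = 1 → ‖u₁‖ = 1 → ‖u₂‖ = 1 →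
      u₁ ∈ r₁.1.carrier.direction → u₂ ∈ r₂.1.carrier.direction →
      inner ℝ e u₁ = ε / r₁.2 → inner ℝ e u₂ ≠ ε / r₂.2

/-! ### Local structure of geodesics -/

section Local

variable {R : Set Road} {ε τ a b c : ℝ} {γ : ℝ → Plane} {r : Road}

/-- Near a given time, on either side, the speed limit along a path is at most the speed of a road
that the path meets arbitrarily close to this time, unless the path is off-road. -/
theorem IsPath.exists_fastest_road (h : IsPath (maxSpeedLimit ε R) τ γ)
    (hfin : FinitelyManyFastRoads ε R) {t₀ : ℝ} (ht₀ : t₀ ∈ Icc 0 τ) {L : Filter ℝ}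
    (hL : L ≤ 𝓝[Icc 0 τ] t₀) :
    (∀ᶠ t in L, maxSpeedLimit ε R (γ t) ≤ ENNReal.ofReal ε) ∨
      ∃ r ∈ R, ε < (r.2 : ℝ) ∧ γ t₀ ∈ r.1.carrier ∧
        (∀ᶠ t in L, maxSpeedLimit ε R (γ t) ≤ ENNReal.ofReal r.2) ∧
        ∃ᶠ t in L, γ t ∈ r.1.carrier := by
  have hlim : Tendsto γ L (𝓝 (γ t₀)) := (h.2.1 t₀ ht₀).mono_left hL
  obtain ⟨n, hn⟩ := exists_nat_gt ‖γ t₀‖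
  have hbd : ∀ᶠ t in L, ‖γ t‖ ≤ n :=
    (hlim.norm.eventually (eventually_lt_nhds hn)).mono fun _ ht => ht.le
  set F := {r ∈ R | ε < (r.2 : ℝ) ∧ ∃ x ∈ r.1.carrier, ‖x‖ ≤ n} with hF
  -- Only the roads of `G` matter along `L`: each other road of the finite set `F` is eventually
  -- avoided, hence all of them are at once.
  set G := {r ∈ F | ∃ᶠ t in L, γ t ∈ r.1.carrier} with hG
  have hGfin : G.Finite := (hfin n).subset fun r hr => hr.1
  have hout : ∀ᶠ t in L, ∀ r ∈ F, r ∉ G → γ t ∉ r.1.carrier := by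
    refine (eventually_all_finite (hfin n)).2 fun r hr => ?_
    by_cases hrG : r ∈ G
    · exact Eventually.of_forall fun t ht => absurd hrG ht
    · have : ¬∃ᶠ t in L, γ t ∈ r.1.carrier := fun hf => hrG ⟨hr, hf⟩
      exact (not_frequently.1 this).mono fun t ht _ => ht
  have hbound : ∀ v : ℝ, ε ≤ v → (∀ r ∈ G, (r.2 : ℝ) ≤ v) →
      ∀ᶠ t in L, maxSpeedLimit ε R (γ t) ≤ ENNReal.ofReal v := by
    intro v hv hGv
    filter_upwards [hbd, hout] with t ht₁ ht₂
    refine max_le (ENNReal.ofReal_le_ofReal hv) (iSup₂_le fun r hr => iSup_le fun hx => ?_)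
    refine ENNReal.ofReal_le_ofReal ?_
    rcases le_or_gt (r.2 : ℝ) ε with hrε | hrε
    · exact hrε.trans hv
    · by_contra hlt
      exact ht₂ r ⟨hr, hrε, _, hx, ht₁⟩ (fun hrG => hlt (hGv r hrG)) hx
  rcases G.eq_empty_or_nonempty with hemp | hne
  · exact Or.inl (hbound ε le_rfl (by simp [hemp]))
  · obtain ⟨r, hrG, hr⟩ := exists_max_image G (fun r : Road => (r.2 : ℝ)) hGfin hne
    refine Or.inr ⟨r, hrG.1.1, hrG.1.2.1, ?_, hbound _ hrG.1.2.1.le hr, hrG.2⟩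
    exact (AffineSubspace.closed_of_finiteDimensional r.1.carrier).mem_of_frequently_of_tendsto
      hrG.2 hlim

/-- Between the times `a` and `b`, the path `γ` either drives linearly at speed `ε`, or drives using
a road of speed greater than `ε`. -/
def IsPiece (R : Set Road) (ε : ℝ) (γ : ℝ → Plane) (a b : ℝ) : Prop :=
  DrivesLinearly γ a b ε ∨ ∃ r ∈ R, ε < (r.2 : ℝ) ∧ DrivesUsing γ a b r

theorem IsPiece.mono {d : ℝ} (h : IsPiece R ε γ a b) (hac : a ≤ c) (hdb : d ≤ b) :
    IsPiece R ε γ c d :=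
  h.imp (fun h => h.mono hac hdb) fun ⟨r, hr, hrε, h⟩ => ⟨r, hr, hrε, h.mono hac hdb⟩

theorem IsGeodesicPath.isPiece_of_le (h : IsGeodesicPath (maxSpeedLimit ε R) τ γ) (hε : 0 < ε)
    (ha : 0 ≤ a) (hab : a ≤ b) (hb : b ≤ τ)
    (hW : ∀ t ∈ Ioo a b, maxSpeedLimit ε R (γ t) ≤ ENNReal.ofReal ε) : IsPiece R ε γ a b :=
  Or.inl (h.1.drivesLinearly hε ha hab hb hW (h.le_dist_offroad hε ha hab hb))

theorem IsGeodesicPath.isPiece_of_le_road (h : IsGeodesicPath (maxSpeedLimit ε R) τ γ)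
    (ha : 0 ≤ a) (hab : a < b) (hb : b ≤ τ) (hr : r ∈ R) (hrε : ε < (r.2 : ℝ))
    (hra : γ a ∈ r.1.carrier) (hrb : γ b ∈ r.1.carrier)
    (hW : ∀ t ∈ Ioo a b, maxSpeedLimit ε R (γ t) ≤ ENNReal.ofReal r.2) : IsPiece R ε γ a b :=
  Or.inr ⟨r, hr, hrε, (h.1.drivesLinearly r.2.2 ha hab.le hb hW
    (h.le_dist_road ha hab.le hb hr hra hrb)).drivesUsing hab hra hrb⟩

/-- If a fastest road exists, `γ a` lies on it and the path returns to it at times arbitrarily close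
to `a`; the piece ends at such a return, chosen early enough for the speed bound to hold. -/
theorem IsGeodesicPath.exists_isPiece_right (h : IsGeodesicPath (maxSpeedLimit ε R) τ γ)
    (hε : 0 < ε) (hfin : FinitelyManyFastRoads ε R) (ha : 0 ≤ a) (haτ : a < τ) :
    ∃ b, a < b ∧ b ≤ τ ∧ IsPiece R ε γ a b := by
  have hL : 𝓝[>] a ≤ 𝓝[Icc 0 τ] a := by
    refine nhdsWithin_le_of_mem (mem_of_superset (Ioo_mem_nhdsGT haτ) fun t ht => ?_)
    exact ⟨ha.trans ht.1.le, ht.2.le⟩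
  rcases h.1.exists_fastest_road hfin ⟨ha, haτ.le⟩ hL with hW | ⟨r, hr, hrε, hra, hW, hfr⟩
  · obtain ⟨b, hab, hb⟩ := mem_nhdsGT_iff_exists_Ioo_subset.1 hW
    have hab : a < b := hab
    refine ⟨min b τ, lt_min hab haτ, min_le_right _ _,
      h.isPiece_of_le hε ha (lt_min hab haτ).le (min_le_right _ _) fun t ht => ?_⟩
    exact hb ⟨ht.1, ht.2.trans_le (min_le_left _ _)⟩
  · obtain ⟨b, hab, hb⟩ := mem_nhdsGT_iff_exists_Ioo_subset.1 hW
    obtain ⟨t, htr, ht⟩ := (hfr.and_eventually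
      (Ioo_mem_nhdsGT (lt_min (show a < b from hab) haτ))).exists
    have htτ : t ≤ τ := (ht.2.trans_le (min_le_right _ _)).le
    exact ⟨t, ht.1, htτ, h.isPiece_of_le_road ha ht.1 htτ hr hrε hra htr
      fun s hs => hb ⟨hs.1, hs.2.trans (ht.2.trans_le (min_le_left _ _))⟩⟩

theorem IsGeodesicPath.exists_isPiece_left (h : IsGeodesicPath (maxSpeedLimit ε R) τ γ)
    (hε : 0 < ε) (hfin : FinitelyManyFastRoads ε R) (hb : 0 < b) (hbτ : b ≤ τ) :
    ∃ a, 0 ≤ a ∧ a < b ∧ IsPiece R ε γ a b := by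
  have hL : 𝓝[<] b ≤ 𝓝[Icc 0 τ] b := by
    refine nhdsWithin_le_of_mem (mem_of_superset (Ioo_mem_nhdsLT hb) fun t ht => ?_)
    exact ⟨ht.1.le, ht.2.le.trans hbτ⟩
  rcases h.1.exists_fastest_road hfin ⟨hb.le, hbτ⟩ hL with hW | ⟨r, hr, hrε, hra, hW, hfr⟩
  · obtain ⟨a, hab, ha⟩ := mem_nhdsLT_iff_exists_Ioo_subset.1 hW
    have hab : a < b := hab
    refine ⟨max a 0, le_max_right _ _, max_lt hab hb,
      h.isPiece_of_le hε (le_max_right _ _) (max_lt hab hb).le hbτ fun t ht => ?_⟩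
    exact ha ⟨(le_max_left _ _).trans_lt ht.1, ht.2⟩
  · obtain ⟨a, hab, ha⟩ := mem_nhdsLT_iff_exists_Ioo_subset.1 hW
    obtain ⟨t, htr, ht⟩ := (hfr.and_eventually
      (Ioo_mem_nhdsLT (max_lt (show a < b from hab) hb))).exists
    have ht0 : 0 ≤ t := ((le_max_right _ _).trans_lt ht.1).le
    exact ⟨t, ht0, ht.2, h.isPiece_of_le_road ht0 ht.2 hbτ hr hrε htr hra
      fun s hs => ha ⟨((le_max_left _ _).trans_lt ht.1).trans hs.1, hs.2⟩⟩

end Local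

/-! ### The law of refraction -/

/-- This is the first-order condition for `s ↦ ‖w - s • u‖ + s * κ` to be minimal at `s = 0`.
Squaring replaces differentiation. -/
theorem inner_eq_of_forall_norm_le {E : Type*} [NormedAddCommGroup E] [InnerProductSpace ℝ E]
    {w u : E} {κ δ : ℝ} (hu : ‖u‖ = 1) (hκ : 0 ≤ κ) (hδ : 0 < δ)
    (h : ∀ s : ℝ, |s| ≤ δ → ‖w‖ ≤ ‖w - s • u‖ + s * κ) : inner ℝ w u = κ * ‖w‖ := by
  rcases eq_or_ne w 0 with rfl | hw
  · simp
  have hw0 : 0 < ‖w‖ := norm_pos_iff.2 hw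
  have key : ∀ s : ℝ, |s| ≤ δ → |s| ≤ ‖w‖ / (κ + 1) →
      2 * s * (inner ℝ w u - κ * ‖w‖) ≤ s ^ 2 := by
    intro s hs hs'
    rw [le_div_iff₀ (by linarith)] at hs'
    -- The bound `‖w‖ / (κ + 1)` on `|s|` keeps `‖w‖ - s * κ` nonnegative, so that squaring
    -- preserves the inequality.
    have h₀ : s * κ ≤ ‖w‖ := by nlinarith [le_abs_self s, abs_nonneg s]
    have h₁ : (‖w‖ - s * κ) ^ 2 ≤ ‖w - s • u‖ ^ 2 :=
      pow_le_pow_left₀ (by linarith) (by linarith [h s hs]) 2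
    rw [norm_sub_sq_real, inner_smul_right, norm_smul, hu, mul_one, Real.norm_eq_abs, sq_abs] at h₁
    nlinarith [sq_nonneg (s * κ)]
  have hpos : 0 < min δ (‖w‖ / (κ + 1)) := lt_min hδ (by positivity)
  by_contra hne
  -- With `d > 0` the gap between the two sides and `0 < s ≤ d`, `key` would give `2 * s * d ≤ s ^ 2
  -- ≤ s * d`.
  rcases lt_or_gt_of_ne hne with hlt | hlt
  · have hm : 0 < min (min δ (‖w‖ / (κ + 1))) (κ * ‖w‖ - inner ℝ w u) :=
      lt_min hpos (by linarith)
    set s := min (min δ (‖w‖ / (κ + 1))) (κ * ‖w‖ - inner ℝ w u)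
    have hs₁ : s ≤ min δ (‖w‖ / (κ + 1)) := min_le_left _ _
    have hs₂ : s ≤ κ * ‖w‖ - inner ℝ w u := min_le_right _ _
    have habs : |-s| = s := by rw [abs_neg, abs_of_pos hm]
    have := key (-s) (habs.le.trans <| hs₁.trans (min_le_left _ _)) (habs.le.trans <| hs₁.trans (min_le_right _ _))
    nlinarith
  · have hm : 0 < min (min δ (‖w‖ / (κ + 1))) (inner ℝ w u - κ * ‖w‖) :=
      lt_min hpos (by linarith)
    set s := min (min δ (‖w‖ / (κ + 1))) (inner ℝ w u - κ * ‖w‖)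
    have hs₁ : s ≤ min δ (‖w‖ / (κ + 1)) := min_le_left _ _
    have hs₂ : s ≤ inner ℝ w u - κ * ‖w‖ := min_le_right _ _
    have habs : |s| = s := abs_of_pos hm
    have := key s (habs.le.trans <| hs₁.trans (min_le_left _ _)) (habs.le.trans <| hs₁.trans (min_le_right _ _))
    nlinarith

section Refraction

variable {R : Set Road} {ε τ a b c : ℝ} {γ : ℝ → Plane} {r : Road}

theorem DrivesUsing.exists_direction (h : DrivesUsing γ a b r) (hab : a < b) :
    ∃ u ∈ r.1.carrier.direction, ‖u‖ = 1 ∧ ∀ t ∈ Icc a b, γ t = γ a + ((t - a) * r.2) • u := by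
  obtain ⟨hmem, u, hu, h⟩ := h
  refine ⟨u, ?_, hu, h⟩
  have hd : γ b - γ a ∈ r.1.carrier.direction :=
    AffineSubspace.vsub_mem_direction (hmem b ⟨hab.le, le_rfl⟩) (hmem a ⟨le_rfl, hab.le⟩)
  have hpos : 0 < (b - a) * r.2 := mul_pos (sub_pos.2 hab) r.2.2
  rw [h b ⟨hab.le, le_rfl⟩, add_sub_cancel_left] at hd
  rwa [Submodule.smul_mem_iff _ hpos.ne'] at hd

/-- The law of refraction for a geodesic that leaves a road. -/
theorem IsGeodesicPath.refraction_leave (h : IsGeodesicPath (maxSpeedLimit ε R) τ γ) (hε : 0 < ε)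
    (ha : 0 ≤ a) (hab : a < b) (hbc : b < c) (hc : c ≤ τ) (hr : r ∈ R)
    (h₁ : DrivesUsing γ a b r) (h₂ : DrivesLinearly γ b c ε) :
    ∃ u ∈ r.1.carrier.direction, ‖u‖ = 1 ∧
      inner ℝ (γ c - γ b) u = ε / r.2 * ‖γ c - γ b‖ := by
  obtain ⟨u, hud, hu, hlin⟩ := h₁.exists_direction hab
  have hv : 0 < (r.2 : ℝ) := r.2.2
  refine ⟨u, hud, hu, inner_eq_of_forall_norm_le hu (by positivity)
    (mul_pos (sub_pos.2 hab) hv) fun s hs => ?_⟩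
  have hγb := hlin b ⟨hab.le, le_rfl⟩
  have hmem : γ b + s • u ∈ r.1.carrier := by
    rw [add_comm]
    exact AffineSubspace.vadd_mem_of_mem_direction (r.1.carrier.direction.smul_mem s hud)
      (h₁.1 b ⟨hab.le, le_rfl⟩)
  -- The competitor leaves the road at `γ b + s • u` instead of `γ b`; the bound on `|s|` keeps this
  -- point from falling behind `γ a`.
  have hle := h.le_of_reach ha (hab.trans hbc).le hc
    ((reach_road hr (h₁.1 a ⟨le_rfl, hab.le⟩) hmem).trans (reach_offroad hε R _ (γ c)))
  have hd₁ : dist (γ a) (γ b + s • u) = (b - a) * r.2 + s := by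
    rw [hγb, add_assoc, ← add_smul, dist_self_add_right, norm_smul, hu, mul_one,
      Real.norm_of_nonneg (by linarith [(abs_le.1 hs).1])]
  have hd₂ : dist (γ b + s • u) (γ c) = ‖γ c - γ b - s • u‖ := by
    rw [dist_comm, dist_eq_norm, sub_sub]
  have hd₃ : ‖γ c - γ b‖ = ε * (c - b) := by
    rw [← dist_eq_norm, dist_comm]
    exact h₂.dist_eq hε.le le_rfl hbc.le le_rfl
  rw [hd₁, hd₂, add_div, mul_div_cancel_right₀ _ hv.ne'] at hle
  have : c - b ≤ s / r.2 + ‖γ c - γ b - s • u‖ / ε := by linarith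
  have := mul_le_mul_of_nonneg_left this hε.le
  rw [hd₃]
  refine this.trans_eq ?_
  field_simp
  ring

/-- The law of refraction for a geodesic that enters a road. -/
theorem IsGeodesicPath.refraction_enter (h : IsGeodesicPath (maxSpeedLimit ε R) τ γ) (hε : 0 < ε)
    (ha : 0 ≤ a) (hab : a < b) (hbc : b < c) (hc : c ≤ τ) (hr : r ∈ R)
    (h₁ : DrivesLinearly γ a b ε) (h₂ : DrivesUsing γ b c r) :
    ∃ u ∈ r.1.carrier.direction, ‖u‖ = 1 ∧
      inner ℝ (γ b - γ a) u = ε / r.2 * ‖γ b - γ a‖ := by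
  obtain ⟨u, hud, hu, hlin⟩ := h₂.exists_direction hbc
  have hv : 0 < (r.2 : ℝ) := r.2.2
  refine ⟨u, hud, hu, inner_eq_of_forall_norm_le hu (by positivity)
    (mul_pos (sub_pos.2 hbc) hv) fun s hs => ?_⟩
  have hγc := hlin c ⟨hbc.le, le_rfl⟩
  -- The entry point slides backwards, so that the drive on the road is again longer by `s`.
  have hmem : γ b + (-s) • u ∈ r.1.carrier := by
    rw [add_comm]
    exact AffineSubspace.vadd_mem_of_mem_direction (r.1.carrier.direction.smul_mem _ hud)
      (h₂.1 b ⟨le_rfl, hbc.le⟩)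
  have hle := h.le_of_reach ha (hab.trans hbc).le hc
    ((reach_offroad hε R (γ a) _).trans (reach_road hr hmem (h₂.1 c ⟨hbc.le, le_rfl⟩)))
  have hd₁ : dist (γ b + (-s) • u) (γ c) = (c - b) * r.2 + s := by
    rw [hγc, dist_add_left, dist_comm, dist_eq_norm, ← sub_smul, norm_smul, hu, mul_one,
      sub_neg_eq_add, Real.norm_of_nonneg (by linarith [(abs_le.1 hs).1])]
  have hd₂ : dist (γ a) (γ b + (-s) • u) = ‖γ b - γ a - s • u‖ := by
    rw [dist_comm, dist_eq_norm, neg_smul]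
    congr 1
    abel
  have hd₃ : ‖γ b - γ a‖ = ε * (b - a) := by
    rw [← dist_eq_norm, dist_comm]
    exact h₁.dist_eq hε.le le_rfl hab.le le_rfl
  rw [hd₁, hd₂, add_div, mul_div_cancel_right₀ _ hv.ne'] at hle
  have : b - a ≤ s / r.2 + ‖γ b - γ a - s • u‖ / ε := by linarith
  have := mul_le_mul_of_nonneg_left this hε.le
  rw [hd₃]
  refine this.trans_eq ?_
  field_simp
  ring

/-- A geodesic does not drive off-road between two roads. -/
theorem IsGeodesicPath.not_offroad_between (h : IsGeodesicPath (maxSpeedLimit ε R) τ γ)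
    (hε : 0 < ε) (hR : NoDoubleRefraction ε R) {d : ℝ} {r₁ r₂ : Road} (ha : 0 ≤ a) (hab : a < b)
    (hbc : b < c) (hcd : c < d) (hd : d ≤ τ) (hr₁ : r₁ ∈ R) (hr₂ : r₂ ∈ R)
    (hε₁ : ε < (r₁.2 : ℝ)) (hε₂ : ε < (r₂.2 : ℝ)) (h₁ : DrivesUsing γ a b r₁)
    (h₂ : DrivesUsing γ c d r₂) : ¬DrivesLinearly γ b c ε := by
  intro h₀
  have hdist := h₀.dist_eq hε.le le_rfl hbc.le le_rfl
  have hpos : 0 < dist (γ b) (γ c) := hdist ▸ mul_pos hε (sub_pos.2 hbc)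
  -- On a single road, following it from `γ b` to `γ c` is strictly faster since its speed exceeds
  -- `ε`. For distinct roads, the unit direction of the segment satisfies both refraction laws.
  rcases eq_or_ne r₁ r₂ with rfl | hne
  · have := h.le_dist_road (ha.trans hab.le) hbc.le (hcd.le.trans hd) hr₁
      (h₁.1 b ⟨hab.le, le_rfl⟩) (h₂.1 c ⟨le_rfl, hcd.le⟩)
    nlinarith [sub_pos.2 hbc]
  · obtain ⟨u₁, hu₁, hn₁, hi₁⟩ :=
      h.refraction_leave hε ha hab hbc (hcd.le.trans hd) hr₁ h₁ h₀
    obtain ⟨u₂, hu₂, hn₂, hi₂⟩ :=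
      h.refraction_enter hε (ha.trans hab.le) hbc hcd hd hr₂ h₀ h₂
    rw [dist_comm, dist_eq_norm] at hpos
    refine hR r₁ hr₁ r₂ hr₂ hε₁ hε₂ hne (‖γ c - γ b‖⁻¹ • (γ c - γ b)) u₁ u₂ ?_ hn₁ hn₂ hu₁ hu₂
      ?_ ?_
    · rw [norm_smul, norm_inv, norm_norm, inv_mul_cancel₀ hpos.ne']
    · rw [real_inner_smul_left, hi₁]; field_simp
    · rw [real_inner_smul_left, hi₂]; field_simp

end Refraction

/-! ### Global structure of geodesics -/

/-- Between the times `a` and `b`, the path `γ` uses finitely many roads of `R`, all of speed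
greater than `ε`, one after the other. -/
inductive RoadChain (R : Set Road) (ε : ℝ) (γ : ℝ → Plane) (a : ℝ) : ℝ → Prop
  | nil : RoadChain R ε γ a a
  | snoc {b c : ℝ} (r : Road) (chain : RoadChain R ε γ a b) (hbc : b < c) (hr : r ∈ R)
      (hrε : ε < (r.2 : ℝ)) (h : DrivesUsing γ b c r) : RoadChain R ε γ a c

section Global

variable {R : Set Road} {ε τ a b c : ℝ} {γ : ℝ → Plane} {r : Road}

theorem RoadChain.le (h : RoadChain R ε γ a b) : a ≤ b := by
  induction h with
  | nil => exact le_rfl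
  | snoc r _ hbc _ _ _ ih => exact ih.trans hbc.le

theorem RoadChain.respectsSpeedLimit (h : RoadChain R ε γ a b) :
    RespectsSpeedLimit (speedLimit R) γ a b := by
  induction h with
  | nil =>
    intro s hs t ht _
    simp [show s = t by linarith [hs.1, hs.2, ht.1, ht.2]]
  | snoc r _ _ hr _ h ih =>
    exact ih.union (h.2.respectsSpeedLimit r.2.2.le fun t ht => le_speedLimit hr (h.1 t ht))

theorem RoadChain.exists_subdivision (h : RoadChain R ε γ a b) :
    ∃ (k : ℕ) (t : Fin (k + 1) → ℝ) (r : Fin k → Road), StrictMono t ∧ t 0 = a ∧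
      t (Fin.last k) = b ∧ (∀ i, r i ∈ R ∧ ε < ((r i).2 : ℝ)) ∧
      ∀ i : Fin k, DrivesUsing γ (t i.castSucc) (t i.succ) (r i) := by
  induction h with
  | nil => exact ⟨0, fun _ => a, Fin.elim0, Fin.strictMono_iff_lt_succ.2 nofun, rfl, rfl, nofun, nofun⟩
  | @snoc b c r _ hbc hr hrε h ih =>
    obtain ⟨k, t, ρ, ht, h0, hlast, hρ, hdr⟩ := ih
    refine ⟨k + 1, Fin.snoc t c, Fin.snoc ρ r, ?_, ?_, by simp, ?_, ?_⟩
    · refine Fin.strictMono_iff_lt_succ.2 fun i => ?_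
      refine Fin.lastCases ?_ (fun i => ?_) i
      · rwa [Fin.snoc_castSucc, Fin.succ_last, Fin.snoc_last, hlast]
      · rw [Fin.snoc_castSucc, ← Fin.castSucc_succ, Fin.snoc_castSucc]
        exact ht Fin.castSucc_lt_succ
    · rw [← Fin.castSucc_zero, Fin.snoc_castSucc, h0]
    · intro i
      refine Fin.lastCases ?_ (fun i => ?_) i
      · simpa using ⟨hr, hrε⟩
      · simpa using hρ i
    · intro i
      refine Fin.lastCases ?_ (fun i => ?_) i
      · rw [Fin.snoc_castSucc, Fin.succ_last, Fin.snoc_last, Fin.snoc_last, hlast]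
        exact h
      · rw [Fin.snoc_castSucc, ← Fin.castSucc_succ, Fin.snoc_castSucc, Fin.snoc_castSucc]
        exact hdr i

/-- Between the times `0` and `t`, the path `γ` drives off-road, then uses finitely many roads, then
drives off-road. -/
def IsStructured (R : Set Road) (ε : ℝ) (γ : ℝ → Plane) (t : ℝ) : Prop :=
  ∃ t₀ t₁, 0 ≤ t₀ ∧ t₁ ≤ t ∧ DrivesLinearly γ 0 t₀ ε ∧ RoadChain R ε γ t₀ t₁ ∧
    DrivesLinearly γ t₁ t ε

/-- An off-road piece merges with the final off-road stretch. A road extends the chain if that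
stretch has length zero; otherwise the chain must be empty, since the stretch would lie between two
roads. -/
theorem IsGeodesicPath.isStructured_append (h : IsGeodesicPath (maxSpeedLimit ε R) τ γ)
    (hε : 0 < ε) (hR : NoDoubleRefraction ε R) (hab : a < b) (hb : b ≤ τ)
    (ha : IsStructured R ε γ a) (hp : IsPiece R ε γ a b) : IsStructured R ε γ b := by
  obtain ⟨t₀, t₁, h0, h1, hl₀, hch, hl₁⟩ := ha
  have h01 := hch.le
  rcases hp with hp | ⟨r, hr, hrε, hp⟩
  · exact ⟨t₀, t₁, h0, h1.trans hab.le, hl₀, hch,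
      h.drivesLinearly_union hε (h0.trans h01) h1 hab.le hb hl₁ hp⟩
  rcases h1.eq_or_lt with rfl | h1
  · exact ⟨t₀, b, h0, le_rfl, hl₀, hch.snoc r hab hr hrε hp, drivesLinearly_self _ _ _⟩
  cases hch with
  | nil =>
    exact ⟨a, b, h0.trans h1.le, le_rfl,
      h.drivesLinearly_union hε le_rfl h0 h1.le (hab.le.trans hb) hl₀ hl₁,
      RoadChain.nil.snoc r hab hr hrε hp, drivesLinearly_self _ _ _⟩
  | snoc r' hch hbc hr' hrε' hp' =>
    exact absurd hl₁ (h.not_offroad_between hε hR (h0.trans hch.le) hbc h1 hab hb hr' hr hrε' hrε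
      hp' hp)

/-- Induction along the interval: a piece ending at the supremum of the good times shows that it is
good, and a piece starting there would pass it. -/
theorem IsGeodesicPath.isStructured (h : IsGeodesicPath (maxSpeedLimit ε R) τ γ)
    (hε : 0 < ε) (hfin : FinitelyManyFastRoads ε R) (hR : NoDoubleRefraction ε R) :
    IsStructured R ε γ τ := by
  set S := {t ∈ Icc 0 τ | IsStructured R ε γ t} with hS
  have hS0 : (0 : ℝ) ∈ S := ⟨⟨le_rfl, h.1.1⟩, 0, 0, le_rfl, le_rfl, drivesLinearly_self _ _ _,
    RoadChain.nil, drivesLinearly_self _ _ _⟩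
  have hbdd : BddAbove S := ⟨τ, fun t ht => ht.1.2⟩
  have hs0 : 0 ≤ sSup S := le_csSup hbdd hS0
  have hsτ : sSup S ≤ τ := csSup_le ⟨0, hS0⟩ fun t ht => ht.1.2
  have hmem : sSup S ∈ S := by
    by_contra hnot
    have hpos : 0 < sSup S := hs0.lt_of_ne fun he => hnot (he ▸ hS0)
    obtain ⟨a, -, hab, hp⟩ := h.exists_isPiece_left hε hfin hpos hsτ
    obtain ⟨t, htS, hat⟩ := exists_lt_of_lt_csSup ⟨0, hS0⟩ hab
    have hts : t < sSup S := (le_csSup hbdd htS).lt_of_ne fun he => hnot (he ▸ htS)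
    exact hnot ⟨⟨hs0, hsτ⟩,
      h.isStructured_append hε hR hts hsτ htS.2 (hp.mono hat.le le_rfl)⟩
  rcases hsτ.eq_or_lt with he | hlt
  · exact he ▸ hmem.2
  · obtain ⟨b, hb, hbτ, hp⟩ := h.exists_isPiece_right hε hfin hs0 hlt
    exact absurd (le_csSup hbdd (show b ∈ S from ⟨⟨hs0.trans hb.le, hbτ⟩,
      h.isStructured_append hε hR hb hbτ hmem.2 hp⟩)) (not_le.2 hb)

theorem IsGeodesicPath.exists_roads (h : IsGeodesicPath (maxSpeedLimit ε R) τ γ)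
    (hε : 0 < ε) (hfin : FinitelyManyFastRoads ε R) (hR : NoDoubleRefraction ε R) :
    ∃ (k : ℕ) (t : Fin (k + 1) → ℝ) (r : Fin k → Road),
      StrictMono t ∧ 0 ≤ t 0 ∧ t (Fin.last k) ≤ τ ∧
      (∀ i : Fin k, r i ∈ R ∧ ε < ((r i).2 : ℝ)) ∧
      DrivesLinearly γ 0 (t 0) ε ∧
      (∀ i : Fin k, DrivesUsing γ (t i.castSucc) (t i.succ) (r i)) ∧
      DrivesLinearly γ (t (Fin.last k)) τ ε ∧
      IsSimplePath R (t (Fin.last k) - t 0) (fun s => γ (t 0 + s)) := by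
  obtain ⟨t₀, t₁, h0, h1, hl₀, hch, hl₁⟩ := h.isStructured hε hfin hR
  obtain ⟨k, t, r, ht, e₀, e₁, hr, hdr⟩ := hch.exists_subdivision
  refine ⟨k, t, r, ht, e₀ ▸ h0, e₁ ▸ h1, hr, e₀ ▸ hl₀, hdr, e₁ ▸ hl₁,
    ⟨?_, ?_, ?_⟩, k, fun i => t i - t 0, r, fun i j hij => sub_lt_sub_right (ht hij) _,
    sub_self _, rfl, fun i => ⟨(hr i).1, DrivesUsing.shift ?_⟩⟩
  · rw [e₀, e₁]
    exact sub_nonneg.2 hch.le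
  · refine h.1.2.1.comp (by fun_prop) fun s hs => ⟨?_, ?_⟩
    · linarith [hs.1]
    · linarith [hs.2]
  · refine RespectsSpeedLimit.shift ?_
    simpa [e₀, e₁] using hch.respectsSpeedLimit
  · simpa using hdr i

end Global

/-! ### Poisson processes -/

theorem poissonMeasure_one_le (m : ℝ≥0) : poissonMeasure m {n | 1 ≤ n} ≤ m := by
  have he : {n : ℕ | 1 ≤ n} = {0}ᶜ := by ext n; simp [Nat.one_le_iff_ne_zero]
  rw [he, prob_compl_eq_one_sub (measurableSet_singleton _), poissonMeasure_singleton,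
    tsub_le_iff_right, ← ENNReal.ofReal_coe_nnreal, ← ENNReal.ofReal_add m.coe_nonneg (by positivity),
    ENNReal.one_le_ofReal]
  have := Real.add_one_le_exp (-(m : ℝ))
  simp only [pow_zero, Nat.factorial_zero, Nat.cast_one]
  linarith

/-- From `exp (-m) ≥ 1 - m` one gets `(1 + m) * exp (-m) ≥ 1 - m ^ 2`. -/
theorem poissonMeasure_two_le (m : ℝ≥0) : poissonMeasure m {n | 2 ≤ n} ≤ m * m := by
  have he : {n : ℕ | 2 ≤ n} = ({0} ∪ {1})ᶜ := by
    ext n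
    simp only [mem_ofPred_eq, mem_compl_iff, mem_union, mem_singleton_iff]
    omega
  rw [he, prob_compl_eq_one_sub (by measurability), measure_union (by simp)
    (measurableSet_singleton _), poissonMeasure_singleton, poissonMeasure_singleton,
    tsub_le_iff_right, ← ENNReal.ofReal_coe_nnreal, ← ENNReal.ofReal_mul m.coe_nonneg,
    ← ENNReal.ofReal_add (by positivity) (by positivity),
    ← ENNReal.ofReal_add (by positivity) (by positivity), ENNReal.one_le_ofReal]
  have := Real.add_one_le_exp (-(m : ℝ))
  have hm : (0 : ℝ) ≤ m := m.2
  simp only [pow_zero, Nat.factorial_zero, Nat.cast_one, Nat.factorial_one, pow_one]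
  nlinarith

section Poisson

variable {Ω X : Type*} [MeasurableSpace Ω] [MeasurableSpace X] {P : Measure Ω} {ν : Measure X}
  {R : Ω → Set X} {A B K : Set X}

theorem IsPoissonProcess.measure_count (h : IsPoissonProcess P ν R) (hB : MeasurableSet B)
    (hν : ν B ≠ ∞) (S : Set ℕ∞) :
    P {ω | (R ω ∩ B).encard ∈ S} = poissonMeasure (ν B).toNNReal {n : ℕ | (n : ℕ∞) ∈ S} := by
  have hS : MeasurableSet S := .of_discrete
  have h₁ := congrArg (fun μ : Measure ℕ∞ => μ S) (h.map_count B hB)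
  simp only [poissonLaw, if_neg hν] at h₁
  rwa [Measure.map_apply (h.measurable_count B hB) hS, Measure.map_apply .of_discrete hS] at h₁

theorem IsPoissonProcess.measure_one_le (h : IsPoissonProcess P ν R) (hB : MeasurableSet B) :
    P {ω | 1 ≤ (R ω ∩ B).encard} ≤ ν B := by
  rcases eq_or_ne (ν B) ∞ with hν | hν
  · simp [hν]
  · have := h.measure_count hB hν {n | 1 ≤ n}
    simp only [mem_ofPred_eq, Nat.one_le_cast] at this
    rw [this]
    exact (poissonMeasure_one_le _).trans_eq (ENNReal.coe_toNNReal hν)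

theorem IsPoissonProcess.measure_two_le (h : IsPoissonProcess P ν R) (hB : MeasurableSet B)
    (hν : ν B ≠ ∞) : P {ω | 2 ≤ (R ω ∩ B).encard} ≤ ν B * ν B := by
  have := h.measure_count hB hν {n | 2 ≤ n}
  simp only [mem_ofPred_eq, Nat.ofNat_le_cast] at this
  rw [this]
  exact (poissonMeasure_two_le _).trans_eq (by rw [ENNReal.coe_toNNReal hν])

theorem IsPoissonProcess.ae_finite (h : IsPoissonProcess P ν R) (hB : MeasurableSet B)
    (hν : ν B ≠ ∞) : ∀ᵐ ω ∂P, (R ω ∩ B).Finite := by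
  have := h.measure_count hB hν {⊤}
  simp only [mem_singleton_iff, ENat.natCast_ne_top, ofPred_false, measure_empty] at this
  simpa [ae_iff] using this

theorem IsPoissonProcess.measure_one_le_inter_le (h : IsPoissonProcess P ν R)
    (hA : MeasurableSet A) (hB : MeasurableSet B) (hAB : Disjoint A B) :
    P ({ω | 1 ≤ (R ω ∩ A).encard} ∩ {ω | 1 ≤ (R ω ∩ B).encard}) ≤ ν A * ν B := by
  have hind := (h.indep_count 2 ![A, B] (by simp [Fin.forall_fin_two, hA, hB]) (by
    intro i j hij
    fin_cases i <;> fin_cases j <;> simp_all [hAB.symm])).indepFun (i := 0) (j := 1) (by simp)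
  have := hind.measure_inter_preimage_eq_mul {n | 1 ≤ n} {n | 1 ≤ n} .of_discrete .of_discrete
  calc _ = P {ω | 1 ≤ (R ω ∩ A).encard} * P {ω | 1 ≤ (R ω ∩ B).encard} := this
    _ ≤ _ := mul_le_mul' (h.measure_one_le hA) (h.measure_one_le hB)

/-- Either both points lie in `A ∩ B`, which then contains two points, or one of them lies in only
one of the two sets, and counts in disjoint sets are independent. -/
theorem IsPoissonProcess.measure_exists_ne_le (h : IsPoissonProcess P ν R)
    (hA : MeasurableSet A) (hB : MeasurableSet B) (hν : ν A ≠ ∞) :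
    P {ω | ∃ x ∈ R ω ∩ A, ∃ y ∈ R ω ∩ B, x ≠ y} ≤ 3 * (ν A * ν B) := by
  have hsub : {ω | ∃ x ∈ R ω ∩ A, ∃ y ∈ R ω ∩ B, x ≠ y} ⊆
      {ω | 2 ≤ (R ω ∩ (A ∩ B)).encard} ∪
        (({ω | 1 ≤ (R ω ∩ (A \ B)).encard} ∩ {ω | 1 ≤ (R ω ∩ B).encard}) ∪
          ({ω | 1 ≤ (R ω ∩ A).encard} ∩ {ω | 1 ≤ (R ω ∩ (B \ A)).encard})) := by
    rintro ω ⟨x, ⟨hx, hxA⟩, y, ⟨hy, hyB⟩, hxy⟩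
    by_cases hxB : x ∈ B
    · by_cases hyA : y ∈ A
      · left
        have h₂ : ({x, y} : Set X).encard ≤ (R ω ∩ (A ∩ B)).encard :=
          encard_le_encard (pair_subset ⟨hx, hxA, hxB⟩ ⟨hy, hyA, hyB⟩)
        rwa [encard_pair hxy] at h₂
      · exact Or.inr (Or.inr ⟨one_le_encard_iff_nonempty.2 ⟨x, hx, hxA⟩,
          one_le_encard_iff_nonempty.2 ⟨y, hy, hyB, hyA⟩⟩)
    · exact Or.inr (Or.inl ⟨one_le_encard_iff_nonempty.2 ⟨x, hx, hxA, hxB⟩,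
        one_le_encard_iff_nonempty.2 ⟨y, hy, hyB⟩⟩)
  calc _ ≤ ν (A ∩ B) * ν (A ∩ B) + (ν (A \ B) * ν B + ν A * ν (B \ A)) := by
        refine (measure_mono hsub).trans ((measure_union_le _ _).trans (add_le_add ?_
          ((measure_union_le _ _).trans (add_le_add ?_ ?_))))
        · exact h.measure_two_le (hA.inter hB) (measure_ne_top_of_subset inter_subset_left hν)
        · exact h.measure_one_le_inter_le (hA.diff hB) hB disjoint_sdiff_left
        · exact h.measure_one_le_inter_le hA (hB.diff hA) disjoint_sdiff_right
    _ ≤ ν A * ν B + (ν A * ν B + ν A * ν B) := by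
        gcongr
        · exact inter_subset_left
        · exact inter_subset_right
        · exact sdiff_subset
        · exact sdiff_subset
    _ = 3 * (ν A * ν B) := by ring

/-- Two real observables of the points of a Poisson process of finite intensity, one of which has
a diffuse law, do not take the same value at distinct points. -/
theorem IsPoissonProcess.ae_ne (h : IsPoissonProcess P ν R) (hK : MeasurableSet K) (hν : ν K ≠ ∞)
    {f g : X → ℝ} (hf : Measurable f) (hg : Measurable g) (hgν : ∀ c, ν (K ∩ g ⁻¹' {c}) = 0) :
    ∀ᵐ ω ∂P, ∀ x ∈ R ω ∩ K, ∀ y ∈ R ω ∩ K, x ≠ y → f x ≠ g y := by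
  set μ := ν.restrict K with hμ
  have : IsFiniteMeasure μ := ⟨by simpa [hμ] using hν.lt_top⟩
  set D : ℕ → Set (X × X) := fun n => {p | (n + 1) * |f p.1 - g p.2| < 1} with hD
  have hDm : ∀ n, MeasurableSet (D n) := fun n => by
    have : Measurable fun p : X × X => (n + 1 : ℝ) * |f p.1 - g p.2| := by fun_prop
    exact measurableSet_lt this measurable_const
  set E := {ω | ∃ x ∈ R ω ∩ K, ∃ y ∈ R ω ∩ K, x ≠ y ∧ f x = g y} with hE
  -- Values are cut into windows of width `1 / (n + 1)`. Equal values share a window, and the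
  -- disjoint products `A i ×ˢ B i` all lie in the strip `D n` around `f x = g y`.
  have hbound : ∀ n, P E ≤ 3 * (μ.prod μ) (D n) := by
    intro n
    set A : ℤ → Set X := fun i => K ∩ {x | ⌊(n + 1) * f x⌋ = i} with hA
    set B : ℤ → Set X := fun i => K ∩ {x | ⌊(n + 1) * g x⌋ = i} with hB
    have hAm : ∀ i, MeasurableSet (A i) := fun i =>
      hK.inter ((hf.const_mul (n + 1 : ℝ)).floor (measurableSet_singleton i))
    have hBm : ∀ i, MeasurableSet (B i) := fun i =>
      hK.inter ((hg.const_mul (n + 1 : ℝ)).floor (measurableSet_singleton i))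
    have hsub : E ⊆ ⋃ i, {ω | ∃ x ∈ R ω ∩ A i, ∃ y ∈ R ω ∩ B i, x ≠ y} := by
      rintro ω ⟨x, ⟨hx, hxK⟩, y, ⟨hy, hyK⟩, hxy, hfg⟩
      exact mem_iUnion.2 ⟨⌊(n + 1) * f x⌋, x, ⟨hx, hxK, rfl⟩, y, ⟨hy, hyK, by simp [hfg]⟩, hxy⟩
    have hdisj : Pairwise fun i j => Disjoint (A i ×ˢ B i) (A j ×ˢ B j) := by
      intro i j hij
      rw [Set.disjoint_prod]
      refine Or.inl (disjoint_left.2 fun x hx hx' => hij ?_)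
      exact hx.2.symm.trans hx'.2
    calc P E ≤ ∑' i, P {ω | ∃ x ∈ R ω ∩ A i, ∃ y ∈ R ω ∩ B i, x ≠ y} :=
          (measure_mono hsub).trans (measure_iUnion_le _)
      _ ≤ ∑' i, 3 * (ν (A i) * ν (B i)) := ENNReal.tsum_le_tsum fun i =>
          h.measure_exists_ne_le (hAm i) (hBm i) (measure_ne_top_of_subset inter_subset_left hν)
      _ = 3 * ∑' i, (μ.prod μ) (A i ×ˢ B i) := by
          rw [ENNReal.tsum_mul_left]
          congr 2 with i
          rw [Measure.prod_prod, hμ, Measure.restrict_eq_self _ inter_subset_left,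
            Measure.restrict_eq_self _ inter_subset_left]
      _ = 3 * (μ.prod μ) (⋃ i, A i ×ˢ B i) := by
          rw [measure_iUnion hdisj fun i => (hAm i).prod (hBm i)]
      _ ≤ 3 * (μ.prod μ) (D n) := by
          gcongr
          refine iUnion_subset fun i p hp => ?_
          have := Int.abs_sub_lt_one_of_floor_eq_floor (hp.1.2.trans hp.2.2.symm)
          rwa [← mul_sub, abs_mul, abs_of_pos (by positivity : (0 : ℝ) < n + 1)] at this
  have hlim : Tendsto (fun n => (μ.prod μ) (D n)) atTop (𝓝 0) := by
    have hanti : Antitone D := fun m n hmn p hp => by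
      simp only [hD, mem_ofPred_eq] at hp ⊢
      refine (mul_le_mul_of_nonneg_right ?_ (abs_nonneg _)).trans_lt hp
      exact_mod_cast Nat.succ_le_succ hmn
    have hlim := tendsto_measure_iInter_atTop (μ := μ.prod μ)
      (fun n => (hDm n).nullMeasurableSet) hanti ⟨0, measure_ne_top _ _⟩
    suffices hzero : (μ.prod μ) (⋂ n, D n) = 0 by rwa [hzero] at hlim
    -- The strips shrink to `f x = g y`, whose sections at fixed `x` are level sets of `g`, null by
    -- hypothesis.
    rw [Measure.measure_prod_null (.iInter hDm)]
    refine Eventually.of_forall fun x => measure_mono_null (t := g ⁻¹' {f x}) (fun y hy => ?_) ?_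
    · have hall : ∀ n : ℕ, (n + 1) * |f x - g y| < 1 := fun n => mem_iInter.1 hy n
      by_contra hne
      have hpos : 0 < |f x - g y| := abs_pos.2 (sub_ne_zero.2 fun he => hne he.symm)
      obtain ⟨n, hn⟩ := exists_nat_gt (1 / |f x - g y|)
      rw [div_lt_iff₀ hpos] at hn
      linarith [hall n]
    · rw [hμ, Measure.restrict_apply (hg (measurableSet_singleton _)), inter_comm]
      exact hgν _
  have hPE : P E = 0 := by
    have hlim₃ := ENNReal.Tendsto.const_mul hlim (Or.inr (by simp : (3 : ℝ≥0∞) ≠ ∞))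
    rw [mul_zero] at hlim₃
    exact le_antisymm (ge_of_tendsto' hlim₃ hbound) zero_le
  refine measure_mono_null (fun ω hω => ?_) hPE
  simp only [mem_compl_iff, mem_ofPred_eq, not_forall, not_not] at hω
  obtain ⟨x, hx, y, hy, hxy, hfg⟩ := hω
  exact ⟨x, hx, y, hy, hxy, hfg⟩

end Poisson

/-! ### Coordinates on the space of lines -/

theorem norm_sq_eq (x : Plane) : ‖x‖ ^ 2 = x 0 ^ 2 + x 1 ^ 2 := by
  simp [EuclideanSpace.norm_sq_eq]

theorem exists_unit_direction (ℓ : Line) : ∃ u ∈ ℓ.carrier.direction, ‖u‖ = 1 := by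
  have : Nontrivial ℓ.carrier.direction :=
    Module.nontrivial_of_finrank_pos (R := ℝ) (by rw [ℓ.finrank_direction]; exact one_pos)
  obtain ⟨u, hu⟩ := exists_norm_eq ℓ.carrier.direction zero_le_one
  exact ⟨u, u.2, hu⟩

/-- The cosine of twice the angle of a line. -/
noncomputable def cosTwiceAngle (ℓ : Line) : ℝ :=
  (exists_unit_direction ℓ).choose 0 ^ 2 - (exists_unit_direction ℓ).choose 1 ^ 2

/-- The sine of twice the angle of a line. -/
noncomputable def sinTwiceAngle (ℓ : Line) : ℝ :=
  2 * (exists_unit_direction ℓ).choose 0 * (exists_unit_direction ℓ).choose 1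

/-- The unit directions of a line are `u` and `-u`, and quadratic expressions do not see the sign.
This makes the choice in the definitions harmless. -/
theorem twiceAngle_eq {ℓ : Line} {u : Plane} (hu : u ∈ ℓ.carrier.direction) (h1 : ‖u‖ = 1) :
    cosTwiceAngle ℓ = u 0 ^ 2 - u 1 ^ 2 ∧ sinTwiceAngle ℓ = 2 * u 0 * u 1 := by
  obtain ⟨hw, hw1⟩ := (exists_unit_direction ℓ).choose_spec
  unfold cosTwiceAngle sinTwiceAngle
  set w := (exists_unit_direction ℓ).choose
  have hu0 : (⟨u, hu⟩ : ℓ.carrier.direction) ≠ 0 := fun h => by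
    have : u = 0 := congrArg Subtype.val h
    simp [this] at h1
  obtain ⟨c, hc⟩ := exists_smul_eq_of_finrank_eq_one ℓ.finrank_direction hu0 ⟨w, hw⟩
  have hc : c • u = w := congrArg Subtype.val hc
  have hc2 : c ^ 2 = 1 := by
    rw [← hc, norm_smul, h1, mul_one, Real.norm_eq_abs] at hw1
    rw [← sq_abs, hw1, one_pow]
  rw [← hc]
  simp only [PiLp.smul_apply, smul_eq_mul]
  exact ⟨by linear_combination (u 0 ^ 2 - u 1 ^ 2) * hc2,
    by linear_combination (2 * u 0 * u 1) * hc2⟩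

theorem twiceAngle_lineOf (p : ℝ × ℝ) : cosTwiceAngle (lineOf p) = Real.cos (2 * p.2) ∧
    sinTwiceAngle (lineOf p) = Real.sin (2 * p.2) := by
  have hdir : rotate p.2 !₂[1, 0] ∈ (lineOf p).carrier.direction := by
    simp only [lineOf, AffineSubspace.direction_mk']
    exact Submodule.mem_span_singleton_self _
  have hnorm : ‖rotate p.2 !₂[1, 0]‖ = 1 := by
    rw [← sq_eq_sq₀ (norm_nonneg _) zero_le_one, norm_sq_eq]
    simp [rotate]
  obtain ⟨h₀, h₁⟩ := twiceAngle_eq hdir hnorm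
  rw [h₀, h₁, Real.cos_two_mul', Real.sin_two_mul]
  simp only [rotate, mul_one, mul_zero, PiLp.toLp_apply, Matrix.cons_val_zero, Matrix.cons_val_one,
    sub_zero, add_zero]
  exact ⟨trivial, by ring⟩

/-- The topology on lines is coinduced by `lineOf`, so continuity is checked in the coordinates `(w,
θ)`. -/
theorem measurable_cosTwiceAngle : Measurable cosTwiceAngle := by
  refine Continuous.measurable (continuous_coinduced_dom.2 ?_)
  have : cosTwiceAngle ∘ lineOf = fun p => Real.cos (2 * p.2) :=
    funext fun p => (twiceAngle_lineOf p).1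
  rw [this]
  fun_prop

theorem measurable_sinTwiceAngle : Measurable sinTwiceAngle := by
  refine Continuous.measurable (continuous_coinduced_dom.2 ?_)
  have : sinTwiceAngle ∘ lineOf = fun p => Real.sin (2 * p.2) :=
    funext fun p => (twiceAngle_lineOf p).2
  rw [this]
  fun_prop

/-- The set of lines that hit the closed ball of radius `ρ` around the origin. -/
def linesHitting (ρ : ℝ) : Set Line := {ℓ | ∃ x ∈ ℓ.carrier, ‖x‖ ≤ ρ}

/-- The point of the line closest to the origin is `rotate θ !₂[0, w]`, at distance `|w|`. -/
theorem lineOf_preimage_linesHitting (ρ : ℝ) :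
    lineOf ⁻¹' linesHitting ρ = Icc (-ρ) ρ ×ˢ univ := by
  ext ⟨w, θ⟩
  have hcs := Real.cos_sq_add_sin_sq θ
  simp only [linesHitting, mem_preimage, mem_ofPred_eq, mem_prod, mem_univ, and_true, mem_Icc,
    ← abs_le, lineOf, AffineSubspace.mem_mk', vsub_eq_sub, Submodule.mem_span_singleton]
  constructor
  · rintro ⟨x, ⟨a, ha⟩, hx⟩
    have hx' : x = rotate θ !₂[0, w] + a • rotate θ !₂[1, 0] := by rw [ha]; abel
    refine le_trans (abs_le_of_sq_le_sq ?_ (norm_nonneg x)) hx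
    rw [norm_sq_eq, hx']
    simp only [rotate, PiLp.add_apply, PiLp.smul_apply, Matrix.cons_val_zero,
      Matrix.cons_val_one, smul_eq_mul]
    nlinarith [sq_nonneg a]
  · intro hw
    refine ⟨rotate θ !₂[0, w], ⟨0, by simp⟩, le_trans ?_ hw⟩
    refine abs_le_of_sq_le_sq' ?_ (abs_nonneg w) |>.2
    rw [norm_sq_eq, sq_abs]
    simp only [rotate, PiLp.toLp_apply, Matrix.cons_val_zero, Matrix.cons_val_one]
    nlinarith

theorem measurableSet_linesHitting (ρ : ℝ) : MeasurableSet (linesHitting ρ) := by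
  refine IsClosed.measurableSet (isClosed_coinduced.2 ?_)
  rw [lineOf_preimage_linesHitting]
  exact isClosed_Icc.prod isClosed_univ

instance : IsFiniteMeasure angleMeasure := by
  unfold angleMeasure
  exact Measure.smul_finite _ (ENNReal.inv_ne_top.2 (by simp [Real.pi_pos]))

instance : SFinite lineMeasure := by
  unfold lineMeasure
  infer_instance

theorem lineMeasure_linesHitting_lt_top (ρ : ℝ) :
    lineMeasure (linesHitting ρ) < ∞ := by
  rw [lineMeasure, Measure.map_apply measurable_lineOf (measurableSet_linesHitting ρ),
    lineOf_preimage_linesHitting, Measure.prod_prod]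
  exact ENNReal.mul_lt_top (by simp) (measure_lt_top _ _)

/-! ### The measure of the set of fast roads -/

instance (β : ℝ) : SFinite (speedMeasure β) := by
  have : IsFiniteMeasureOnCompacts ((volume : Measure ℝ).comap ((↑) : Ioi (0 : ℝ) → ℝ)) :=
    .comap' _ continuous_subtype_val (.subtype_coe measurableSet_Ioi)
  have : LocallyCompactSpace (Ioi (0 : ℝ)) := isOpen_Ioi.locallyCompactSpace
  unfold speedMeasure
  infer_instance

theorem speedMeasure_lt_top {β ε : ℝ} (hβ : 1 < β) (hε : 0 < ε) :
    speedMeasure β {v | ε < (v : ℝ)} < ∞ := by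
  have hm : MeasurableSet {v : Ioi (0 : ℝ) | ε < (v : ℝ)} :=
    measurableSet_lt measurable_const measurable_subtype_coe
  rw [speedMeasure, withDensity_apply _ hm, ← lintegral_indicator hm]
  have heq : ({v : Ioi (0 : ℝ) | ε < (v : ℝ)}.indicator fun v => ENNReal.ofReal ((v : ℝ) ^ (-β))) =
      fun v : Ioi (0 : ℝ) => (Ioi ε).indicator (fun x => ENNReal.ofReal (x ^ (-β))) v := by
    ext v
    simp [indicator]
  rw [heq, lintegral_subtype_comap measurableSet_Ioi, lintegral_indicator measurableSet_Ioi,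
    Measure.restrict_restrict measurableSet_Ioi]
  refine (lintegral_mono_set inter_subset_left).trans_lt ?_
  exact (integrableOn_Ioi_rpow_of_lt (by linarith) hε).lintegral_lt_top

/-! ### The refraction direction of a road and its diffuse law. -/

theorem countable_cos_eq (a x : ℝ) : {θ : ℝ | Real.cos (2 * θ + a) = x}.Countable := by
  rcases Set.eq_empty_or_nonempty {θ : ℝ | Real.cos (2 * θ + a) = x} with h | ⟨θ₀, hθ₀⟩
  · simp [h]
  · refine ((countable_range fun k : ℤ => (2 * θ₀ - 2 * k * Real.pi) / 2).union
      (countable_range fun k : ℤ => (2 * k * Real.pi - (2 * θ₀ + a) - a) / 2)).mono fun θ hθ => ?_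
    have h : Real.cos (2 * θ + a) = Real.cos (2 * θ₀ + a) := Eq.trans hθ (Eq.symm hθ₀)
    obtain ⟨k, hk | hk⟩ := Real.cos_eq_cos_iff.1 h
    · exact Or.inl ⟨k, by simp only; linarith⟩
    · exact Or.inr ⟨k, by simp only; linarith⟩

/-- The cosine of twice the angle of the direction in which a driver of speed `ε` leaves or enters
the given road, according to the law of refraction; the sign `σ` selects a side of the road. -/
noncomputable def refractionCos (ε σ : ℝ) (r : Road) : ℝ :=
  cosTwiceAngle r.1 * Real.cos (2 * σ * Real.arccos (ε / r.2)) -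
    sinTwiceAngle r.1 * Real.sin (2 * σ * Real.arccos (ε / r.2))

theorem measurable_refractionCos (ε σ : ℝ) : Measurable (refractionCos ε σ) := by
  have h₀ := measurable_cosTwiceAngle
  have h₁ := measurable_sinTwiceAngle
  have h₂ : Measurable fun r : Road => 2 * σ * Real.arccos (ε / r.2) :=
    (Real.measurable_arccos.comp
      (measurable_const.div (measurable_subtype_coe.comp measurable_snd))).const_mul _
  exact ((h₀.comp measurable_fst).mul (Real.measurable_cos.comp h₂)).sub
    ((h₁.comp measurable_fst).mul (Real.measurable_sin.comp h₂))

theorem refractionCos_lineOf (ε σ : ℝ) (p : ℝ × ℝ) (v : Ioi (0 : ℝ)) :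
    refractionCos ε σ (lineOf p, v) = Real.cos (2 * p.2 + 2 * σ * Real.arccos (ε / v)) := by
  rw [refractionCos, (twiceAngle_lineOf p).1, (twiceAngle_lineOf p).2, Real.cos_add]

/-- By Fubini it suffices to fix the speed and `w`: the condition becomes `cos (2 * θ + const) = x`,
which holds for countably many angles only. -/
theorem roadIntensity_refractionCos_eq (β c ε σ x : ℝ) :
    roadIntensity β c (refractionCos ε σ ⁻¹' {x}) = 0 := by
  have hm := measurable_refractionCos ε σ (measurableSet_singleton x)
  have h0 : (lineMeasure.prod (speedMeasure β)) (refractionCos ε σ ⁻¹' {x}) = 0 := by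
    rw [Measure.prod_apply_symm hm, lintegral_eq_zero_of_ae_eq_zero]
    refine Eventually.of_forall fun v => ?_
    have hm' := measurable_prodMk_right (y := v) hm
    simp only [Pi.zero_apply]
    rw [lineMeasure, Measure.map_apply measurable_lineOf hm',
      Measure.measure_prod_null (measurable_lineOf hm')]
    refine Eventually.of_forall fun w => ?_
    have hc := (countable_cos_eq (2 * σ * Real.arccos (ε / v)) x).measure_zero
      (volume.restrict (Ioc 0 (2 * Real.pi)))
    simp only [Pi.zero_apply, angleMeasure, Measure.smul_apply, smul_eq_mul]
    rw [show Prod.mk w ⁻¹' (lineOf ⁻¹' ((fun ℓ => (ℓ, v)) ⁻¹' (refractionCos ε σ ⁻¹' {x}))) =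
      {θ | Real.cos (2 * θ + 2 * σ * Real.arccos (ε / v)) = x} from ?_, hc, mul_zero]
    ext θ
    simp [refractionCos_lineOf]
  rw [roadIntensity, Measure.smul_apply, h0, smul_zero]

/-- The set of roads of speed greater than `ε` that hit the closed ball of radius `n`. -/
def fastRoadsHitting (ε : ℝ) (n : ℕ) : Set Road := linesHitting n ×ˢ {v : Ioi (0 : ℝ) | ε < (v : ℝ)}

theorem measurableSet_fastRoadsHitting (ε : ℝ) (n : ℕ) :
    MeasurableSet (fastRoadsHitting ε n) :=
  (measurableSet_linesHitting n).prod
    (measurableSet_lt measurable_const measurable_subtype_coe)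

theorem roadIntensity_fastRoadsHitting_ne_top {β c ε : ℝ} (hβ : 1 < β) (hε : 0 < ε) (n : ℕ) :
    roadIntensity β c (fastRoadsHitting ε n) ≠ ∞ := by
  rw [roadIntensity, Measure.smul_apply, fastRoadsHitting, Measure.prod_prod, smul_eq_mul]
  exact ENNReal.mul_ne_top ENNReal.ofReal_ne_top
    (ENNReal.mul_lt_top (lineMeasure_linesHitting_lt_top n)
      (speedMeasure_lt_top hβ hε)).ne

/-- A direction of off-road driving that satisfies the law of refraction. -/
theorem exists_refractionCos_eq {ε : ℝ} (hε : 0 < ε) {r : Road} (hr : ε < (r.2 : ℝ)) {e u : Plane}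
    (he : ‖e‖ = 1) (hu : ‖u‖ = 1) (hud : u ∈ r.1.carrier.direction)
    (h : inner ℝ e u = ε / r.2) :
    ∃ b : Bool, refractionCos ε (if b then 1 else -1) r = e 0 ^ 2 - e 1 ^ 2 := by
  obtain ⟨h₀, h₁⟩ := twiceAngle_eq hud hu
  have he' : e 0 ^ 2 + e 1 ^ 2 = 1 := by rw [← norm_sq_eq, he, one_pow]
  have hu' : u 0 ^ 2 + u 1 ^ 2 = 1 := by rw [← norm_sq_eq, hu, one_pow]
  have hv : 0 < (r.2 : ℝ) := r.2.2
  set α := Real.arccos (ε / r.2) with hα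
  have hcos : Real.cos α = e 0 * u 0 + e 1 * u 1 := by
    rw [hα, Real.cos_arccos (by linarith [div_pos hε hv]) ((div_le_one hv).2 hr.le), ← h]
    simp [PiLp.inner_apply, Fin.sum_univ_two, mul_comm]
  -- Lagrange's identity for the unit vectors `e` and `u`. It fixes `sin α` up to a sign, which is
  -- the side `σ`.
  have hsin : Real.sin α ^ 2 = (e 1 * u 0 - e 0 * u 1) ^ 2 := by
    rw [Real.sin_sq, hcos]
    linear_combination (-1 : ℝ) * he' * (u 0 ^ 2 + u 1 ^ 2) - hu'
  have hsgn : ∀ σ : ℝ, 2 * σ * α = 2 * (σ * α) := fun σ => by ring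
  rcases sq_eq_sq_iff_eq_or_eq_neg.1 hsin with hs | hs
  · refine ⟨true, ?_⟩
    rw [refractionCos, ← hα, h₀, h₁, hsgn, if_pos rfl, one_mul, Real.cos_two_mul',
      Real.sin_two_mul, hs, hcos]
    linear_combination (e 0 ^ 2 - e 1 ^ 2) * (u 0 ^ 2 + u 1 ^ 2 + 1) * hu'
  · refine ⟨false, ?_⟩
    rw [refractionCos, ← hα, h₀, h₁, hsgn, if_neg Bool.false_ne_true, neg_one_mul,
      Real.cos_two_mul', Real.sin_two_mul, Real.cos_neg, Real.sin_neg, hs, hcos]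
    linear_combination (e 0 ^ 2 - e 1 ^ 2) * (u 0 ^ 2 + u 1 ^ 2 + 1) * hu'

/-! ### Almost sure properties of the process of roads -/

section AlmostSure

variable {Ω : Type*} [MeasurableSpace Ω] {P : Measure Ω} {β c ε : ℝ} {R : Ω → Set Road}

theorem IsPoissonProcess.ae_finitelyManyFastRoads (h : IsPoissonProcess P (roadIntensity β c) R)
    (hβ : 1 < β) (hε : 0 < ε) : ∀ᵐ ω ∂P, FinitelyManyFastRoads ε (R ω) := by
  refine ae_all_iff.2 fun n => ?_
  filter_upwards [h.ae_finite (measurableSet_fastRoadsHitting ε n)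
    (roadIntensity_fastRoadsHitting_ne_top hβ hε n)] with ω hω
  exact hω.subset fun r hr => ⟨hr.1, hr.2.2, hr.2.1⟩

/-- A direction `e` refracted by both roads would give them the common value `e 0 ^ 2 - e 1 ^ 2` of
`refractionCos`, for suitable signs. Balls of integer radius and pairs of signs make this a
countable family of null events. -/
theorem IsPoissonProcess.ae_noDoubleRefraction (h : IsPoissonProcess P (roadIntensity β c) R)
    (hβ : 1 < β) (hε : 0 < ε) : ∀ᵐ ω ∂P, NoDoubleRefraction ε (R ω) := by
  have key : ∀ᵐ ω ∂P, ∀ (n : ℕ) (b b' : Bool), ∀ r₁ ∈ R ω ∩ fastRoadsHitting ε n,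
      ∀ r₂ ∈ R ω ∩ fastRoadsHitting ε n, r₁ ≠ r₂ →
        refractionCos ε (if b then 1 else -1) r₁ ≠ refractionCos ε (if b' then 1 else -1) r₂ := by
    refine ae_all_iff.2 fun n => ae_all_iff.2 fun b => ae_all_iff.2 fun b' => ?_
    exact h.ae_ne (measurableSet_fastRoadsHitting ε n)
      (roadIntensity_fastRoadsHitting_ne_top hβ hε n) (measurable_refractionCos ε _)
      (measurable_refractionCos ε _) fun x =>
        measure_mono_null inter_subset_right (roadIntensity_refractionCos_eq β c ε _ x)
  filter_upwards [key] with ω hω r₁ hr₁ r₂ hr₂ hε₁ hε₂ hne e u₁ u₂ he hu₁ hu₂ hd₁ hd₂ hi₁ hi₂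
  obtain ⟨b, hb⟩ := exists_refractionCos_eq hε hε₁ he hu₁ hd₁ hi₁
  obtain ⟨b', hb'⟩ := exists_refractionCos_eq hε hε₂ he hu₂ hd₂ hi₂
  -- The empty affine subspace has a direction of rank zero, so a `Line` has points.
  have hhit : ∀ r : Road, ∃ x, x ∈ r.1.carrier := fun r => by
    by_contra hemp
    have hbot : r.1.carrier = ⊥ :=
      (AffineSubspace.coe_eq_bot_iff _).1 (eq_empty_of_forall_notMem fun x hx => hemp ⟨x, hx⟩)
    have := r.1.finrank_direction
    rw [hbot, AffineSubspace.direction_bot, finrank_bot] at this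
    exact zero_ne_one this
  obtain ⟨x₁, hx₁⟩ := hhit r₁
  obtain ⟨x₂, hx₂⟩ := hhit r₂
  obtain ⟨n, hn⟩ := exists_nat_ge (max ‖x₁‖ ‖x₂‖)
  exact hω n b b' r₁ ⟨hr₁, ⟨x₁, hx₁, (le_max_left _ _).trans hn⟩, hε₁⟩
    r₂ ⟨hr₂, ⟨x₂, hx₂, (le_max_right _ _).trans hn⟩, hε₂⟩ hne (hb.trans hb'.symm)

end AlmostSure

end PoissonRoads

theorem proposition3 {Ω : Type*} [MeasurableSpace Ω] (P : Measure Ω) [IsProbabilityMeasure P]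
    (β : ℝ) (hβ : 2 < β) (c : ℝ) (hc : 0 < c) (R : Ω → Set PoissonRoads.Road)
    (hR : PoissonRoads.IsPoissonProcess P (PoissonRoads.roadIntensity β c) R)
    (ε : ℝ) (hε : 0 < ε) :
    ∀ᵐ ω ∂P, ∀ (τ : ℝ) (γ : ℝ → PoissonRoads.Plane),
      PoissonRoads.IsGeodesicPath (PoissonRoads.maxSpeedLimit ε (R ω)) τ γ →
      ∃ (k : ℕ) (t : Fin (k + 1) → ℝ) (r : Fin k → PoissonRoads.Road),
        StrictMono t ∧ 0 ≤ t 0 ∧ t (Fin.last k) ≤ τ ∧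
        (∀ i : Fin k, r i ∈ R ω ∧ ε < ((r i).2 : ℝ)) ∧
        PoissonRoads.DrivesLinearly γ 0 (t 0) ε ∧
        (∀ i : Fin k, PoissonRoads.DrivesUsing γ (t i.castSucc) (t i.succ) (r i)) ∧
        PoissonRoads.DrivesLinearly γ (t (Fin.last k)) τ ε ∧
        PoissonRoads.IsSimplePath (R ω) (t (Fin.last k) - t 0) (fun s => γ (t 0 + s)) := by
  filter_upwards [hR.ae_finitelyManyFastRoads (by linarith) hε,
    hR.ae_noDoubleRefraction (by linarith) hε] with ω hfin href τ γ hγ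
  exact hγ.exists_roads hε hfin href
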